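/- Let $(M,g)$ be an oriented smooth Riemannian manifold of dimension $4$ and let $f\colon M\to\mathbb R$ be a smooth function such that $(M,g,f)$ is a gradient steady Ricci soliton, $\mathrm{Ric}+\nabla\nabla f=0$, or a gradient shrinking Ricci soliton, $\mathrm{Ric}+\nabla\nabla f=\rho g$ with a constant $\rho>0$. Let $W$ be the Weyl tensor of $g$ and let $W^{+}=\tfrac12(W+{\star}W)$ be its self-dual part, where the Hodge star acts on the first pair of indices; thus, in an oriented orthonormal basis, $W^+=0$ means $W_{12kl}=-W_{34kl}$, $W_{13kl}=-W_{42kl}$ and $W_{14kl}=-W_{23kl}$ for all $k,l$. Suppose that $W^{+}=0$ on $M$, and let $q\in M$ be a point with $\nabla f(q)\neq 0$. Then $W=0$ at $q$. Moreover, at $q$ the vector $\nabla f$ is an eigenvector of $\mathrm{Ric}$, and the restriction of $\mathrm{Ric}$ to $(\nabla f)^{\perp}$ is a multiple of $g$. -/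

import Mathlib

open scoped Manifold ContDiff

noncomputable section

namespace RicciSoliton

/-- The model space `ℝ⁴`. -/
abbrev R4 : Type := EuclideanSpace ℝ (Fin 4)

/-! ### Riemannian geometry of a metric `G = (g_{ij})` on an open subset of `ℝ⁴`

All indices are lowered unless said otherwise. Indices are raised with the inverse matrix
`G⁻¹ = (g^{ij})`. -/

/-- The partial derivative `∂ᵢ F` at `x`. -/
def pd (i : Fin 4) (F : R4 → ℝ) (x : R4) : ℝ :=
  fderiv ℝ F x (EuclideanSpace.single i 1)

/-- The Christoffel symbol `Γᵏᵢⱼ = ½ gᵏˡ (∂ᵢ gⱼₗ + ∂ⱼ gᵢₗ - ∂ₗ gᵢⱼ)` of the Levi-Civita connection. -/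
def christoffel (G : R4 → Matrix (Fin 4) (Fin 4) ℝ) (x : R4) (k i j : Fin 4) : ℝ :=
  (1 / 2) * ∑ l, (G x)⁻¹ k l *
    (pd i (fun y => G y j l) x + pd j (fun y => G y i l) x - pd l (fun y => G y i j) x)

/-- The component `dxᵐ (R(∂ᵢ, ∂ⱼ) ∂ₗ)` of the curvature operator
`R(X, Y) Z = ∇_X ∇_Y Z - ∇_Y ∇_X Z - ∇_[X,Y] Z`. -/
def curvatureUp (G : R4 → Matrix (Fin 4) (Fin 4) ℝ) (x : R4) (m i j l : Fin 4) : ℝ :=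
  pd i (fun y => christoffel G y m j l) x - pd j (fun y => christoffel G y m i l) x
    + ∑ p, (christoffel G x m i p * christoffel G x p j l
      - christoffel G x m j p * christoffel G x p i l)

/-- The Riemann tensor `R_{ijkl} = g(R(∂ᵢ, ∂ⱼ) ∂ₗ, ∂ₖ)`; with this sign `R_{ijij} > 0` on spheres. -/
def riemann (G : R4 → Matrix (Fin 4) (Fin 4) ℝ) (x : R4) (i j k l : Fin 4) : ℝ :=
  ∑ m, G x k m * curvatureUp G x m i j l

/-- The Ricci tensor `R_{jl} = g^{ik} R_{ijkl}`. -/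
def ricci (G : R4 → Matrix (Fin 4) (Fin 4) ℝ) (x : R4) (j l : Fin 4) : ℝ :=
  ∑ i, ∑ k, (G x)⁻¹ i k * riemann G x i j k l

/-- The scalar curvature `R = g^{jl} R_{jl}`. -/
def scalarCurvature (G : R4 → Matrix (Fin 4) (Fin 4) ℝ) (x : R4) : ℝ :=
  ∑ j, ∑ l, (G x)⁻¹ j l * ricci G x j l

/-- The Weyl tensor `W_{ijkl}` in dimension `n = 4`, so that `1 / (n - 2) = 1 / 2` and
`1 / ((n - 1) (n - 2)) = 1 / 6`. -/
def weyl (G : R4 → Matrix (Fin 4) (Fin 4) ℝ) (x : R4) (i j k l : Fin 4) : ℝ :=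
  riemann G x i j k l
    - (1 / 2) * (ricci G x i k * G x j l + ricci G x j l * G x i k
        - ricci G x i l * G x j k - ricci G x j k * G x i l)
    + (scalarCurvature G x / 6) * (G x i k * G x j l - G x i l * G x j k)

/-- The Levi-Civita symbol: the sign of `(i, j, k, l)` if it is a permutation of
`(0, 1, 2, 3)`, and `0` otherwise. -/
def leviCivitaSymbol (i j k l : Fin 4) : ℝ :=
  ((Matrix.of fun a b : Fin 4 => if ![i, j, k, l] a = b then (1 : ℤ) else 0).det : ℤ)

/-- The components of the Riemannian volume form; `s` is `1` if the coordinates are positively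
oriented at `x` and `-1` if they are negatively oriented. -/
def volumeForm (s : ℝ) (G : R4 → Matrix (Fin 4) (Fin 4) ℝ) (x : R4) (i j k l : Fin 4) : ℝ :=
  s * Real.sqrt (G x).det * leviCivitaSymbol i j k l

/-- The Hodge star acting on the first pair of indices of the Weyl tensor,
`(⋆W)_{ijkl} = ½ vol_{ij}^{mn} W_{mnkl}`. -/
def starWeyl (s : ℝ) (G : R4 → Matrix (Fin 4) (Fin 4) ℝ) (x : R4) (i j k l : Fin 4) : ℝ :=
  (1 / 2) * ∑ m, ∑ n, ∑ a, ∑ b,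
    volumeForm s G x i j a b * (G x)⁻¹ a m * (G x)⁻¹ b n * weyl G x m n k l

/-- The self-dual part `W⁺ = ½ (W + ⋆W)` of the Weyl tensor. -/
def weylPlus (s : ℝ) (G : R4 → Matrix (Fin 4) (Fin 4) ℝ) (x : R4) (i j k l : Fin 4) : ℝ :=
  (1 / 2) * (weyl G x i j k l + starWeyl s G x i j k l)

/-- The Hessian `∇ᵢ∇ⱼ F = ∂ᵢ∂ⱼ F - Γᵏᵢⱼ ∂ₖ F`. -/
def hessian (G : R4 → Matrix (Fin 4) (Fin 4) ℝ) (F : R4 → ℝ) (x : R4) (i j : Fin 4) : ℝ :=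
  pd i (pd j F) x - ∑ k, christoffel G x k i j * pd k F x

/-- The gradient `(∇F)ⁱ = gⁱʲ ∂ⱼ F`. -/
def gradient (G : R4 → Matrix (Fin 4) (Fin 4) ℝ) (F : R4 → ℝ) (x : R4) (i : Fin 4) : ℝ :=
  ∑ j, (G x)⁻¹ i j * pd j F x

/-! ### Oriented Riemannian 4-manifolds -/

section Manifold

variable {M : Type*} [TopologicalSpace M] [ChartedSpace R4 M]

/-- The coordinate vector `∂ᵢ` of the chart `e` at the point with coordinates `x`. -/
def coordVec (e : OpenPartialHomeomorph M R4) (x : R4) (i : Fin 4) :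
    TangentSpace (𝓡 4) (e.symm x) :=
  mfderiv (𝓡 4) (𝓡 4) e.symm x (EuclideanSpace.single i 1 : R4)

/-- The sign of the coordinate frame `(∂₁, ∂₂, ∂₃, ∂₄)` of the chart `e`, at the point with
coordinates `x`, with respect to orientations `o p` of the tangent spaces. (An orientation is a
ray of nonzero alternating 4-forms; the sign does not depend on the form chosen in the ray.) -/
def frameSign (o : ∀ p : M, Orientation ℝ (TangentSpace (𝓡 4) p) (Fin 4))
    (e : OpenPartialHomeomorph M R4) (x : R4) : SignType :=
  SignType.sign ((o (e.symm x)).someVector (coordVec e x))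

variable (M) in
/-- An orientation of the manifold `M`: an orientation of each tangent space such that the sign of
every coordinate frame is locally constant. -/
structure ManifoldOrientation where
  tangent : ∀ p : M, Orientation ℝ (TangentSpace (𝓡 4) p) (Fin 4)
  locallyConstant : ∀ e ∈ IsManifold.maximalAtlas (𝓡 4) ∞ M, ∀ x ∈ e.target,
    ∀ᶠ y in nhds x, frameSign tangent e y = frameSign tangent e x

variable [IsManifold (𝓡 4) ∞ M]

variable (M) in
/-- Smooth Riemannian metrics on `M`. -/
abbrev Metric : Type _ :=
  Bundle.ContMDiffRiemannianMetric (𝓡 4) ∞ R4 (fun p : M => TangentSpace (𝓡 4) p)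

/-- The components `g_{ij}` of the metric in the chart `e`. -/
def metricIn (g : Metric M) (e : OpenPartialHomeomorph M R4) (x : R4) :
    Matrix (Fin 4) (Fin 4) ℝ :=
  Matrix.of fun i j => g.inner (e.symm x) (coordVec e x i) (coordVec e x j)

/-- `Ric + ∇∇f = ρ g` on `M`, with `f` smooth. The equation between tensors is read in local
coordinates: it holds for the components in every smooth chart, at every point of the chart. -/
structure IsGradientRicciSoliton (g : Metric M) (f : M → ℝ) (ρ : ℝ) : Prop where
  smooth : ContMDiff (𝓡 4) 𝓘(ℝ, ℝ) ∞ f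
  equation : ∀ e ∈ IsManifold.maximalAtlas (𝓡 4) ∞ M, ∀ x ∈ e.target, ∀ i j : Fin 4,
    ricci (metricIn g e) x i j + hessian (metricIn g e) (f ∘ e.symm) x i j
      = ρ * metricIn g e x i j

/-- A gradient steady Ricci soliton: `Ric + ∇∇f = 0`. -/
def IsGradientSteadySoliton (g : Metric M) (f : M → ℝ) : Prop :=
  IsGradientRicciSoliton g f 0

/-- A gradient shrinking Ricci soliton: `Ric + ∇∇f = ρ g` with a constant `ρ > 0`. -/
def IsGradientShrinkingSoliton (g : Metric M) (f : M → ℝ) : Prop :=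
  ∃ ρ : ℝ, 0 < ρ ∧ IsGradientRicciSoliton g f ρ

/-- `W⁺ = 0` on the oriented Riemannian manifold `M` (in every smooth chart). -/
def IsAntiSelfDual (o : ManifoldOrientation M) (g : Metric M) : Prop :=
  ∀ e ∈ IsManifold.maximalAtlas (𝓡 4) ∞ M, ∀ x ∈ e.target, ∀ i j k l : Fin 4,
    weylPlus (frameSign o.tangent e x : ℝ) (metricIn g e) x i j k l = 0

/-- The Weyl tensor vanishes at `q` (in every smooth chart around `q`). -/
def WeylVanishesAt (g : Metric M) (q : M) : Prop :=
  ∀ e ∈ IsManifold.maximalAtlas (𝓡 4) ∞ M, q ∈ e.source → ∀ i j k l : Fin 4,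
    weyl (metricIn g e) (e q) i j k l = 0

/-- At `q`, the gradient of `f` is an eigenvector of `Ric` (the first two conjuncts) and `Ric` is a
multiple of the metric on the orthogonal complement of `∇f` (the last one), in every smooth chart
around `q`. -/
def RicciSplitsAlongGradientAt (g : Metric M) (f : M → ℝ) (q : M) : Prop :=
  ∀ e ∈ IsManifold.maximalAtlas (𝓡 4) ∞ M, q ∈ e.source →
    let G := metricIn g e
    let v := gradient G (f ∘ e.symm) (e q)
    v ≠ 0 ∧
    (∃ lam : ℝ, ∀ i, ∑ j, ricci G (e q) i j * v j = lam * ∑ j, G (e q) i j * v j) ∧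
    (∃ mu : ℝ, ∀ a b : Fin 4 → ℝ,
      (∑ i, ∑ j, G (e q) i j * a i * v j = 0) → (∑ i, ∑ j, G (e q) i j * b i * v j = 0) →
      ∑ i, ∑ j, ricci G (e q) i j * a i * b j = mu * ∑ i, ∑ j, G (e q) i j * a i * b j)

end Manifold

end RicciSoliton

end

/-!
A gradient Ricci soliton couples the curvature to `∇f` in two ways. By the Ricci identity, the
soliton equation `Ric + ∇∇f = ρ g` gives `∇ₐRic_{bd} - ∇_bRic_{ad} = R_{abld} ∇ˡf`, and with the
contracted Bianchi identities this makes the divergence of the Weyl tensor algebraic in the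
curvature and `∇f` (`SolitonFrame.div_weyl`).

If `W⁺ = 0`, then the divergence of `W` is anti-self-dual in its first two indices, and so is
`W(·, ·, ∇f, ·)`. Their difference, up to a factor, is the tensor `D` of Cao and Chen, which only
involves `Ric`, `g` and `∇f`. In an orthonormal frame with `e₀ = ∇f / |∇f|`, the components of `D`
on pairs orthogonal to `e₀` only involve `Ric(e₀, ·)`; anti-self-duality then forces
`Ric(e₀, eₐ) = 0` for `a ≠ 0`, and `Ric` to be a multiple of `g` on the complement of `e₀`
(`SolitonFrame.ricci_split`).

Hence `Ric = μ g + ν df ⊗ df` wherever `∇f ≠ 0`, with differentiable coefficients. Differentiating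
this gives `∇ₐRic_{bd} = (∂ₐμ) g_{bd}` for indices orthogonal to `∇f`, so that `R_{ab0d}` is
expressed by `dμ`; its trace is `Ric(e₀, eₐ) = 0`, whence `dμ` vanishes on the complement of `∇f` and
`R_{ab0d} = W_{ab0d} = 0`. Anti-self-duality of `W` converts this into `W = 0`
(`SolitonFrame.weyl_eq_zero`).

The algebra takes place at one point in an orthonormal frame. The link with the coordinate
definitions is `parallelFrame`, a frame field whose covariant derivative vanishes at the point: the
ordinary derivatives of the components of a tensor in this frame are the components of its covariant
derivative (`matPd_pullTwo`, `matPd_pullFour`), while the components of the metric and of the volume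
form are constant to first order. Thus the relations between frame components of `R`, `Ric`, `W` and
`⋆W`, which hold near the point, can be differentiated by the product rule. Nothing depends on the
sign of the orientation: the frame algebra works for `W + σ ⋆ W = 0` with any real `σ`.
-/

noncomputable section

namespace RicciSoliton

/-! ### Differential calculus of coordinate components -/

section Calculus

variable {F H : R4 → ℝ} {x : R4} {U : Set R4}

theorem fderiv_eq_sum_pd (F : R4 → ℝ) (x u : R4) :
    fderiv ℝ F x u = ∑ p, u p * pd p F x := by
  have h : u = ∑ p, u p • EuclideanSpace.single p (1 : ℝ) := by
    ext i
    simp [Finset.sum_apply, Pi.single_apply]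
  conv_lhs => rw [h]
  simp [pd]

theorem pd_congr {p : Fin 4} (h : F =ᶠ[nhds x] H) : pd p F x = pd p H x := by
  unfold pd
  rw [h.fderiv_eq]

theorem pd_const (p : Fin 4) (c : ℝ) : pd p (fun _ => c) x = 0 := by
  simp [pd]

theorem pd_add (p : Fin 4) (hF : DifferentiableAt ℝ F x) (hH : DifferentiableAt ℝ H x) :
    pd p (fun y => F y + H y) x = pd p F x + pd p H x := by
  unfold pd
  rw [fderiv_fun_add hF hH]
  simp

theorem pd_sub (p : Fin 4) (hF : DifferentiableAt ℝ F x) (hH : DifferentiableAt ℝ H x) :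
    pd p (fun y => F y - H y) x = pd p F x - pd p H x := by
  unfold pd
  rw [fderiv_fun_sub hF hH]
  simp

theorem pd_mul (p : Fin 4) (hF : DifferentiableAt ℝ F x) (hH : DifferentiableAt ℝ H x) :
    pd p (fun y => F y * H y) x = pd p F x * H x + F x * pd p H x := by
  unfold pd
  rw [fderiv_fun_mul hF hH]
  simp
  ring

theorem pd_const_mul (p : Fin 4) (c : ℝ) (hF : DifferentiableAt ℝ F x) :
    pd p (fun y => c * F y) x = c * pd p F x := by
  rw [pd_mul p (differentiableAt_const c) hF, pd_const]
  ring

theorem pd_sum {ι : Type*} (s : Finset ι) (p : Fin 4) {F : ι → R4 → ℝ}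
    (hF : ∀ i ∈ s, DifferentiableAt ℝ (F i) x) :
    pd p (fun y => ∑ i ∈ s, F i y) x = ∑ i ∈ s, pd p (F i) x := by
  unfold pd
  rw [fderiv_fun_sum hF]
  simp

theorem _root_.ContDiffOn.pd (hU : IsOpen U) (hF : ContDiffOn ℝ ∞ F U) (p : Fin 4) :
    ContDiffOn ℝ ∞ (pd p F) U :=
  (hF.fderiv_of_isOpen hU (m := ∞) (by simp)).clm_apply contDiffOn_const

theorem _root_.ContDiffOn.differentiableAt_of_isOpen (hU : IsOpen U) (hF : ContDiffOn ℝ ∞ F U)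
    (hx : x ∈ U) : DifferentiableAt ℝ F x :=
  (hF.differentiableOn (by simp)).differentiableAt (hU.mem_nhds hx)

theorem pd_comm (hU : IsOpen U) (hF : ContDiffOn ℝ ∞ F U) (hx : x ∈ U) (p q : Fin 4) :
    pd p (pd q F) x = pd q (pd p F) x := by
  have hd : DifferentiableAt ℝ (fderiv ℝ F) x :=
    ((hF.fderiv_of_isOpen hU (m := ∞) (by simp)).differentiableOn
      (by simp)).differentiableAt (hU.mem_nhds hx)
  have hs : IsSymmSndFDerivAt ℝ F x :=
    (hF.contDiffAt (hU.mem_nhds hx)).isSymmSndFDerivAt (by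
      rw [minSmoothness_of_isRCLikeNormedField]
      exact WithTop.coe_le_coe.2 (le_top : (2 : ℕ∞) ≤ ⊤))
  have key : ∀ a b : Fin 4, RicciSoliton.pd a (RicciSoliton.pd b F) x
      = fderiv ℝ (fderiv ℝ F) x (EuclideanSpace.single a 1) (EuclideanSpace.single b 1) := by
    intro a b
    unfold RicciSoliton.pd
    rw [fderiv_clm_apply hd (differentiableAt_const _)]
    simp
  rw [key, key]
  exact hs _ _

theorem pd_neg (p : Fin 4) (F : R4 → ℝ) (x : R4) : pd p (fun y => -F y) x = -pd p F x := by
  unfold pd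
  rw [fderiv_fun_neg]
  simp

theorem pd_prod_eq_zero {ι : Type*} (s : Finset ι) (p : Fin 4) {F : ι → R4 → ℝ}
    (hF : ∀ i ∈ s, DifferentiableAt ℝ (F i) x) (h0 : ∀ i ∈ s, pd p (F i) x = 0) :
    DifferentiableAt ℝ (fun y => ∏ i ∈ s, F i y) x ∧ pd p (fun y => ∏ i ∈ s, F i y) x = 0 := by
  classical
  induction s using Finset.induction_on with
  | empty => simp [pd_const]
  | insert a s ha ih =>
    have h1 := ih (fun i hi => hF i (Finset.mem_insert_of_mem hi))
      (fun i hi => h0 i (Finset.mem_insert_of_mem hi))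
    have h2 := hF a (Finset.mem_insert_self a s)
    simp only [Finset.prod_insert ha]
    refine ⟨h2.fun_mul h1.1, ?_⟩
    rw [pd_mul p h2 h1.1, h1.2, h0 a (Finset.mem_insert_self a s), zero_mul, mul_zero, add_zero]

theorem pd_eq_zero_of_mul_self (p : Fin 4) (hF : DifferentiableAt ℝ F x) (hx : F x ≠ 0)
    (h : pd p (fun y => F y * F y) x = 0) : pd p F x = 0 := by
  rw [pd_mul p hF hF] at h
  have : F x * pd p F x = 0 := by linarith
  exact (mul_eq_zero.1 this).resolve_left hx

end Calculus

section MatrixCalculus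

variable {S T : R4 → Matrix (Fin 4) (Fin 4) ℝ} {x : R4} {U : Set R4}

/-- A matrix-valued function with differentiable entries at `x`. -/
def MatDiffAt (S : R4 → Matrix (Fin 4) (Fin 4) ℝ) (x : R4) : Prop :=
  ∀ i j, DifferentiableAt ℝ (fun y => S y i j) x

/-- A matrix-valued function with smooth entries on `U`. -/
def MatSmoothOn (S : R4 → Matrix (Fin 4) (Fin 4) ℝ) (U : Set R4) : Prop :=
  ∀ i j, ContDiffOn ℝ ∞ (fun y => S y i j) U

/-- The entrywise partial derivative of a matrix-valued function. -/
def matPd (p : Fin 4) (S : R4 → Matrix (Fin 4) (Fin 4) ℝ) (x : R4) : Matrix (Fin 4) (Fin 4) ℝ :=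
  Matrix.of fun i j => pd p (fun y => S y i j) x

theorem MatSmoothOn.matDiffAt (hU : IsOpen U) (hS : MatSmoothOn S U) (hx : x ∈ U) :
    MatDiffAt S x := fun i j => (hS i j).differentiableAt_of_isOpen hU hx

theorem MatSmoothOn.matPd (hU : IsOpen U) (hS : MatSmoothOn S U) (p : Fin 4) :
    MatSmoothOn (matPd p S) U := fun i j => (hS i j).pd hU p

theorem MatSmoothOn.mul (hS : MatSmoothOn S U) (hT : MatSmoothOn T U) :
    MatSmoothOn (fun y => S y * T y) U := by
  intro i j
  simp only [Matrix.mul_apply]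
  exact ContDiffOn.sum fun k _ => (hS i k).mul (hT k j)

theorem MatSmoothOn.add (hS : MatSmoothOn S U) (hT : MatSmoothOn T U) :
    MatSmoothOn (fun y => S y + T y) U := fun i j => (hS i j).add (hT i j)

theorem MatSmoothOn.sub (hS : MatSmoothOn S U) (hT : MatSmoothOn T U) :
    MatSmoothOn (fun y => S y - T y) U := fun i j => (hS i j).sub (hT i j)

theorem MatSmoothOn.transpose (hS : MatSmoothOn S U) :
    MatSmoothOn (fun y => (S y).transpose) U := fun i j => hS j i

theorem MatDiffAt.mul (hS : MatDiffAt S x) (hT : MatDiffAt T x) :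
    MatDiffAt (fun y => S y * T y) x := by
  intro i j
  simp only [Matrix.mul_apply]
  exact DifferentiableAt.fun_sum fun k _ => (hS i k).mul (hT k j)

theorem MatDiffAt.add (hS : MatDiffAt S x) (hT : MatDiffAt T x) :
    MatDiffAt (fun y => S y + T y) x := fun i j => (hS i j).add (hT i j)

theorem MatDiffAt.sub (hS : MatDiffAt S x) (hT : MatDiffAt T x) :
    MatDiffAt (fun y => S y - T y) x := fun i j => (hS i j).sub (hT i j)

theorem MatDiffAt.transpose (hS : MatDiffAt S x) :
    MatDiffAt (fun y => (S y).transpose) x := fun i j => hS j i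

theorem matPd_congr {p : Fin 4} (h : S =ᶠ[nhds x] T) : matPd p S x = matPd p T x := by
  ext i j
  exact pd_congr (h.mono fun y hy => by simp only [hy])

theorem matPd_const (p : Fin 4) (C : Matrix (Fin 4) (Fin 4) ℝ) : matPd p (fun _ => C) x = 0 := by
  ext i j
  exact pd_const p _

theorem matPd_add (p : Fin 4) (hS : MatDiffAt S x) (hT : MatDiffAt T x) :
    matPd p (fun y => S y + T y) x = matPd p S x + matPd p T x := by
  ext i j
  exact pd_add p (hS i j) (hT i j)

theorem matPd_sub (p : Fin 4) (hS : MatDiffAt S x) (hT : MatDiffAt T x) :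
    matPd p (fun y => S y - T y) x = matPd p S x - matPd p T x := by
  ext i j
  exact pd_sub p (hS i j) (hT i j)

theorem matPd_mul (p : Fin 4) (hS : MatDiffAt S x) (hT : MatDiffAt T x) :
    matPd p (fun y => S y * T y) x = matPd p S x * T x + S x * matPd p T x := by
  ext i j
  simp only [matPd, Matrix.mul_apply, Matrix.add_apply, Matrix.of_apply]
  rw [pd_sum _ _ fun k _ => (hS i k).fun_mul (hT k j), ← Finset.sum_add_distrib]
  exact Finset.sum_congr rfl fun k _ => pd_mul p (hS i k) (hT k j)

theorem matPd_transpose (p : Fin 4) :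
    matPd p (fun y => (S y).transpose) x = (matPd p S x).transpose := rfl

theorem matPd_neg (p : Fin 4) (S : R4 → Matrix (Fin 4) (Fin 4) ℝ) (x : R4) :
    matPd p (fun y => -S y) x = -matPd p S x := by
  ext i j
  exact pd_neg p _ x

/-- Where the derivative of `S` vanishes, so does the derivative of `det S`. -/
theorem pd_det_eq_zero (p : Fin 4) (hS : MatDiffAt S x) (h0 : matPd p S x = 0) :
    pd p (fun y => (S y).det) x = 0 := by
  have h1 : ∀ σ : Equiv.Perm (Fin 4), _ := fun σ => pd_prod_eq_zero (x := x) Finset.univ p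
    (F := fun i y => S y (σ i) i) (fun i _ => hS _ _)
    (fun i _ => congrFun (congrFun h0 (σ i)) i)
  simp only [Matrix.det_apply']
  rw [pd_sum _ _ fun σ _ => (h1 σ).1.const_mul _]
  refine Finset.sum_eq_zero fun σ _ => ?_
  rw [pd_const_mul p _ (h1 σ).1, (h1 σ).2, mul_zero]

theorem matPd_comm (hU : IsOpen U) (hS : MatSmoothOn S U) (hx : x ∈ U) (p q : Fin 4) :
    matPd p (matPd q S) x = matPd q (matPd p S) x := by
  ext i j
  exact pd_comm hU (hS i j) hx p q

theorem MatSmoothOn.det (hS : MatSmoothOn S U) : ContDiffOn ℝ ∞ (fun y => (S y).det) U := by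
  simp only [Matrix.det_apply']
  exact ContDiffOn.sum fun σ _ => contDiffOn_const.mul (contDiffOn_prod fun i _ => hS _ _)

theorem MatSmoothOn.inv (hS : MatSmoothOn S U) (h : ∀ y ∈ U, (S y).det ≠ 0) :
    MatSmoothOn (fun y => (S y)⁻¹) U := by
  intro i j
  have hadj : ContDiffOn ℝ ∞ (fun y => (S y).adjugate i j) U := by
    simp only [Matrix.adjugate_apply]
    refine MatSmoothOn.det (S := fun y => (S y).updateRow j (Pi.single i 1)) fun a b => ?_
    by_cases hab : a = j
    · subst hab
      simp only [Matrix.updateRow_self]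
      exact contDiffOn_const
    · simp only [Matrix.updateRow_ne hab]
      exact hS a b
  have hEq : ∀ y, (S y)⁻¹ i j = ((S y).det)⁻¹ * (S y).adjugate i j := by
    intro y
    simp [Matrix.inv_def]
  simp only [hEq]
  exact (hS.det.inv h).mul hadj

/-- Where the derivative of `S` vanishes, so does the derivative of `S⁻¹`. -/
theorem matPd_inv_eq_zero (hU : IsOpen U) (hS : MatSmoothOn S U) (h : ∀ y ∈ U, (S y).det ≠ 0)
    (hx : x ∈ U) (p : Fin 4) (h0 : matPd p S x = 0) : matPd p (fun y => (S y)⁻¹) x = 0 := by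
  have hinv := (hS.inv h).matDiffAt hU hx
  have h1 : matPd p (fun y => S y * (S y)⁻¹) x = 0 := by
    rw [← matPd_const (x := x) p 1]
    refine matPd_congr ?_
    filter_upwards [hU.mem_nhds hx] with y hy
    exact Matrix.mul_nonsing_inv _ (h y hy).isUnit
  rw [matPd_mul p (hS.matDiffAt hU hx) hinv, h0, zero_mul, zero_add] at h1
  have := congrArg (fun C => (S x)⁻¹ * C) h1
  simpa [← mul_assoc, Matrix.nonsing_inv_mul _ (h x hx).isUnit] using this

end MatrixCalculus

/-! ### The Levi-Civita connection and its curvature in coordinates -/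

section Connection

/-- A smooth Riemannian metric on an open subset `U` of `ℝ⁴`. -/
structure IsMetricOn (G : R4 → Matrix (Fin 4) (Fin 4) ℝ) (U : Set R4) : Prop where
  isOpen : IsOpen U
  smooth : MatSmoothOn G U
  posDef : ∀ x ∈ U, (G x).PosDef

/-- The connection matrix `Γ_p` with entries `(Γ_p)ᵏⱼ = Γᵏₚⱼ`. -/
def connMat (G : R4 → Matrix (Fin 4) (Fin 4) ℝ) (p : Fin 4) (x : R4) :
    Matrix (Fin 4) (Fin 4) ℝ :=
  Matrix.of fun k j => christoffel G x k p j

/-- The matrix of the curvature operator `R(∂ᵢ, ∂ⱼ)`. -/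
def curvMat (G : R4 → Matrix (Fin 4) (Fin 4) ℝ) (i j : Fin 4) (x : R4) :
    Matrix (Fin 4) (Fin 4) ℝ :=
  Matrix.of fun m l => curvatureUp G x m i j l

/-- The matrix `(R_{ijkl})_{kl}` of the Riemann tensor with fixed first pair of indices. -/
def riemMat (G : R4 → Matrix (Fin 4) (Fin 4) ℝ) (i j : Fin 4) (x : R4) :
    Matrix (Fin 4) (Fin 4) ℝ :=
  Matrix.of fun k l => riemann G x i j k l

variable {G : R4 → Matrix (Fin 4) (Fin 4) ℝ} {x : R4} {U : Set R4}

namespace IsMetricOn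

theorem symm (h : IsMetricOn G U) (hx : x ∈ U) (i j : Fin 4) : G x i j = G x j i := by
  have := (h.posDef x hx).isHermitian.apply j i
  simpa using this

theorem transpose_eq (h : IsMetricOn G U) (hx : x ∈ U) : (G x).transpose = G x := by
  ext i j
  exact h.symm hx j i

theorem det_pos (h : IsMetricOn G U) (hx : x ∈ U) : 0 < (G x).det := (h.posDef x hx).det_pos

theorem det_ne_zero (h : IsMetricOn G U) : ∀ y ∈ U, (G y).det ≠ 0 :=
  fun _ hy => (h.det_pos hy).ne'

theorem pd_symm (h : IsMetricOn G U) (hx : x ∈ U) (p i j : Fin 4) :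
    pd p (fun y => G y i j) x = pd p (fun y => G y j i) x := by
  refine pd_congr ?_
  filter_upwards [h.isOpen.mem_nhds hx] with y hy
  exact h.symm hy i j

theorem christoffel_symm (h : IsMetricOn G U) (hx : x ∈ U) (k i j : Fin 4) :
    christoffel G x k i j = christoffel G x k j i := by
  unfold christoffel
  congr 1
  refine Finset.sum_congr rfl fun l _ => ?_
  rw [h.pd_symm hx l i j]
  ring

theorem sum_mul_christoffel (h : IsMetricOn G U) (hx : x ∈ U) (m i j : Fin 4) :
    ∑ k, G x m k * christoffel G x k i j
      = (1 / 2) * (pd i (fun y => G y j m) x + pd j (fun y => G y i m) x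
        - pd m (fun y => G y i j) x) := by
  have hu : G x * (G x)⁻¹ = 1 := Matrix.mul_nonsing_inv _ (h.det_ne_zero x hx).isUnit
  set b : Fin 4 → ℝ := fun l => pd i (fun y => G y j l) x + pd j (fun y => G y i l) x
    - pd l (fun y => G y i j) x with hb
  have h1 : ∀ k, christoffel G x k i j = ((1 / 2 : ℝ) • ((G x)⁻¹.mulVec b)) k := by
    intro k
    simp [christoffel, Matrix.mulVec, dotProduct, hb]
  have h2 : ∑ k, G x m k * christoffel G x k i j
      = ((G x).mulVec ((1 / 2 : ℝ) • ((G x)⁻¹.mulVec b))) m := by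
    simp only [h1, Matrix.mulVec, dotProduct]
  rw [h2, Matrix.mulVec_smul, Matrix.mulVec_mulVec, hu, Matrix.one_mulVec]
  simp [hb]

/-- The Levi-Civita connection is compatible with the metric. -/
theorem matPd_eq (h : IsMetricOn G U) (hx : x ∈ U) (p : Fin 4) :
    matPd p G x = (connMat G p x).transpose * G x + G x * connMat G p x := by
  ext i j
  have h1 := h.sum_mul_christoffel hx j p i
  have h2 := h.sum_mul_christoffel hx i p j
  have h3 : ∑ k, christoffel G x k p i * G x k j = ∑ k, G x j k * christoffel G x k p i :=
    Finset.sum_congr rfl fun k _ => by rw [h.symm hx k j, mul_comm]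
  simp only [matPd, connMat, Matrix.add_apply, Matrix.mul_apply, Matrix.of_apply,
    Matrix.transpose_apply]
  rw [h3, h1, h2, h.pd_symm hx i p j, h.pd_symm hx j p i, h.pd_symm hx p j i,
    h.pd_symm hx i j p]
  ring

theorem smooth_inv (h : IsMetricOn G U) : MatSmoothOn (fun y => (G y)⁻¹) U :=
  h.smooth.inv h.det_ne_zero

theorem smooth_christoffel (h : IsMetricOn G U) (k i j : Fin 4) :
    ContDiffOn ℝ ∞ (fun y => christoffel G y k i j) U := by
  unfold christoffel
  refine contDiffOn_const.mul (ContDiffOn.sum fun l _ => (h.smooth_inv k l).mul ?_)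
  exact (((h.smooth j l).pd h.isOpen i).add ((h.smooth i l).pd h.isOpen j)).sub
    ((h.smooth i j).pd h.isOpen l)

theorem smooth_connMat (h : IsMetricOn G U) (p : Fin 4) : MatSmoothOn (connMat G p) U :=
  fun k j => h.smooth_christoffel k p j

end IsMetricOn

theorem curvMat_eq (G : R4 → Matrix (Fin 4) (Fin 4) ℝ) (i j : Fin 4) (x : R4) :
    curvMat G i j x = matPd i (connMat G j) x - matPd j (connMat G i) x
      + connMat G i x * connMat G j x - connMat G j x * connMat G i x := by
  ext m l
  simp only [curvMat, curvatureUp, matPd, connMat, Matrix.sub_apply, Matrix.add_apply,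
    Matrix.mul_apply, Matrix.of_apply, Finset.sum_sub_distrib]
  ring

theorem riemMat_eq (G : R4 → Matrix (Fin 4) (Fin 4) ℝ) (i j : Fin 4) :
    riemMat G i j = fun y => G y * curvMat G i j y := by
  ext y k l
  simp [riemMat, riemann, curvMat, Matrix.mul_apply]

theorem curvMat_swap (G : R4 → Matrix (Fin 4) (Fin 4) ℝ) (i j : Fin 4) (x : R4) :
    curvMat G i j x = -curvMat G j i x := by
  rw [curvMat_eq, curvMat_eq]
  abel

theorem riemMat_swap (G : R4 → Matrix (Fin 4) (Fin 4) ℝ) (i j : Fin 4) (x : R4) :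
    riemMat G i j x = -riemMat G j i x := by
  rw [riemMat_eq, riemMat_eq]
  simp only []
  rw [curvMat_swap, mul_neg]

namespace IsMetricOn

theorem smooth_curvMat (h : IsMetricOn G U) (i j : Fin 4) : MatSmoothOn (curvMat G i j) U := by
  have : curvMat G i j = fun x => matPd i (connMat G j) x - matPd j (connMat G i) x
      + connMat G i x * connMat G j x - connMat G j x * connMat G i x :=
    funext fun x => curvMat_eq G i j x
  rw [this]
  have hi := h.smooth_connMat i
  have hj := h.smooth_connMat j
  exact (((hj.matPd h.isOpen i).sub (hi.matPd h.isOpen j)).add (hi.mul hj)).sub (hj.mul hi)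

theorem smooth_riemMat (h : IsMetricOn G U) (i j : Fin 4) : MatSmoothOn (riemMat G i j) U := by
  rw [riemMat_eq]
  exact h.smooth.mul (h.smooth_curvMat i j)

/-- The antisymmetry `R_{ijkl} = -R_{ijlk}`: the mixed second derivatives of the metric commute. -/
theorem riemMat_transpose (h : IsMetricOn G U) (hx : x ∈ U) (i j : Fin 4) :
    (riemMat G i j x).transpose = -riemMat G i j x := by
  have key : ∀ a b : Fin 4, matPd a (matPd b G) x
      = (matPd a (connMat G b) x).transpose * G x
        + (connMat G b x).transpose * ((connMat G a x).transpose * G x + G x * connMat G a x)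
        + (((connMat G a x).transpose * G x + G x * connMat G a x) * connMat G b x
        + G x * matPd a (connMat G b) x) := by
    intro a b
    have hb := (h.smooth_connMat b).matDiffAt h.isOpen hx
    have hG := h.smooth.matDiffAt h.isOpen hx
    have : matPd b G =ᶠ[nhds x] fun y => (connMat G b y).transpose * G y + G y * connMat G b y := by
      filter_upwards [h.isOpen.mem_nhds hx] with y hy
      exact h.matPd_eq hy b
    rw [matPd_congr this, matPd_add a (hb.transpose.mul hG) (hG.mul hb),
      matPd_mul a hb.transpose hG, matPd_mul a hG hb, matPd_transpose, h.matPd_eq hx a]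
  have hcomm := matPd_comm h.isOpen h.smooth hx i j
  rw [key, key, ← sub_eq_zero] at hcomm
  rw [eq_neg_iff_add_eq_zero, riemMat_eq]
  simp only [Matrix.transpose_mul, h.transpose_eq hx]
  rw [curvMat_eq]
  simp only [Matrix.transpose_sub, Matrix.transpose_add, Matrix.transpose_mul]
  rw [← hcomm]
  noncomm_ring

/-- The first Bianchi identity. -/
theorem curvatureUp_cyclic (h : IsMetricOn G U) (hx : x ∈ U) (m i j l : Fin 4) :
    curvatureUp G x m i j l + curvatureUp G x m j l i + curvatureUp G x m l i j = 0 := by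
  have hs : ∀ p a b c : Fin 4, pd p (fun y => christoffel G y a b c) x
      = pd p (fun y => christoffel G y a c b) x := by
    intro p a b c
    refine pd_congr ?_
    filter_upwards [h.isOpen.mem_nhds hx] with y hy
    exact h.christoffel_symm hy a b c
  unfold curvatureUp
  simp only [Finset.sum_sub_distrib]
  rw [hs i m l j, hs j m l i, hs l m j i]
  simp only [h.christoffel_symm hx _ l j, h.christoffel_symm hx _ l i, h.christoffel_symm hx _ j i]
  ring

theorem riemann_cyclic (h : IsMetricOn G U) (hx : x ∈ U) (i j k l : Fin 4) :
    riemann G x i j k l + riemann G x j l k i + riemann G x l i k j = 0 := by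
  unfold riemann
  rw [← Finset.sum_add_distrib, ← Finset.sum_add_distrib]
  refine Finset.sum_eq_zero fun m _ => ?_
  rw [← mul_add, ← mul_add, h.curvatureUp_cyclic hx, mul_zero]

end IsMetricOn

/-- The covariant derivative along `∂ₚ` of the Riemann tensor, where the connection acts on the
second pair of indices only. -/
def covRiemPair (G : R4 → Matrix (Fin 4) (Fin 4) ℝ) (p i j : Fin 4) (x : R4) :
    Matrix (Fin 4) (Fin 4) ℝ :=
  matPd p (riemMat G i j) x - (connMat G p x).transpose * riemMat G i j x
    - riemMat G i j x * connMat G p x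

/-- The covariant derivative `∇ₚR_{ij··}` of the Riemann tensor. -/
def covRiem (G : R4 → Matrix (Fin 4) (Fin 4) ℝ) (p i j : Fin 4) (x : R4) :
    Matrix (Fin 4) (Fin 4) ℝ :=
  covRiemPair G p i j x - ∑ m, christoffel G x m p i • riemMat G m j x
    - ∑ m, christoffel G x m p j • riemMat G i m x

namespace IsMetricOn

/-- The Bianchi identity for the curvature form of the connection. -/
theorem covRiemPair_cyclic (h : IsMetricOn G U) (hx : x ∈ U) (p i j : Fin 4) :
    covRiemPair G p i j x + covRiemPair G i j p x + covRiemPair G j p i x = 0 := by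
  have hG := h.smooth.matDiffAt h.isOpen hx
  have key : ∀ a b c : Fin 4, covRiemPair G a b c x
      = G x * (matPd a (matPd b (connMat G c)) x - matPd a (matPd c (connMat G b)) x
        + matPd a (connMat G b) x * connMat G c x + connMat G b x * matPd a (connMat G c) x
        - matPd a (connMat G c) x * connMat G b x - connMat G c x * matPd a (connMat G b) x
        + connMat G a x * curvMat G b c x - curvMat G b c x * connMat G a x) := by
    intro a b c
    have hb := (h.smooth_connMat b).matDiffAt h.isOpen hx
    have hc := (h.smooth_connMat c).matDiffAt h.isOpen hx
    have hbc := ((h.smooth_connMat c).matPd h.isOpen b).matDiffAt h.isOpen hx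
    have hcb := ((h.smooth_connMat b).matPd h.isOpen c).matDiffAt h.isOpen hx
    have hcurv := (h.smooth_curvMat b c).matDiffAt h.isOpen hx
    have h1 : matPd a (curvMat G b c) x
        = matPd a (matPd b (connMat G c)) x - matPd a (matPd c (connMat G b)) x
        + (matPd a (connMat G b) x * connMat G c x + connMat G b x * matPd a (connMat G c) x)
        - (matPd a (connMat G c) x * connMat G b x
          + connMat G c x * matPd a (connMat G b) x) := by
      rw [funext fun y => curvMat_eq G b c y, matPd_sub a ((hbc.sub hcb).add (hb.mul hc))
        (hc.mul hb), matPd_add a (hbc.sub hcb) (hb.mul hc), matPd_sub a hbc hcb,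
        matPd_mul a hb hc, matPd_mul a hc hb]
    unfold covRiemPair
    rw [riemMat_eq, matPd_mul a hG hcurv, h.matPd_eq hx a, h1]
    noncomm_ring
  rw [key, key, key, ← mul_add, ← mul_add, matPd_comm h.isOpen (h.smooth_connMat j) hx p i,
    matPd_comm h.isOpen (h.smooth_connMat p) hx i j,
    matPd_comm h.isOpen (h.smooth_connMat i) hx j p, curvMat_eq, curvMat_eq, curvMat_eq]
  convert mul_zero _
  noncomm_ring

/-- The second Bianchi identity. -/
theorem covRiem_cyclic (h : IsMetricOn G U) (hx : x ∈ U) (p i j : Fin 4) :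
    covRiem G p i j x + covRiem G i j p x + covRiem G j p i x = 0 := by
  have h0 := h.covRiemPair_cyclic hx p i j
  have hs : ∀ a b c : Fin 4, ∑ m, christoffel G x m a b • riemMat G c m x
      = -∑ m, christoffel G x m b a • riemMat G m c x := by
    intro a b c
    rw [← Finset.sum_neg_distrib]
    refine Finset.sum_congr rfl fun m _ => ?_
    rw [h.christoffel_symm hx, riemMat_swap, smul_neg]
  unfold covRiem
  rw [hs p j i, hs i p j, hs j i p, ← h0]
  abel

end IsMetricOn

/-- The covariant derivative along `∂ₚ` of a 2-tensor. -/
def covTwo (G : R4 → Matrix (Fin 4) (Fin 4) ℝ) (p : Fin 4) (T : R4 → Matrix (Fin 4) (Fin 4) ℝ)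
    (x : R4) : Matrix (Fin 4) (Fin 4) ℝ :=
  matPd p T x - (connMat G p x).transpose * T x - T x * connMat G p x

/-- The Hessian as a matrix-valued function. -/
def hessMat (G : R4 → Matrix (Fin 4) (Fin 4) ℝ) (F : R4 → ℝ) (x : R4) :
    Matrix (Fin 4) (Fin 4) ℝ :=
  Matrix.of fun i j => hessian G F x i j

namespace IsMetricOn

variable {F : R4 → ℝ}

theorem hessian_symm (h : IsMetricOn G U) (hF : ContDiffOn ℝ ∞ F U) (hx : x ∈ U) (i j : Fin 4) :
    hessian G F x i j = hessian G F x j i := by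
  unfold hessian
  rw [pd_comm h.isOpen hF hx]
  simp only [h.christoffel_symm hx _ i j]

theorem smooth_hessMat (h : IsMetricOn G U) (hF : ContDiffOn ℝ ∞ F U) :
    MatSmoothOn (hessMat G F) U := fun i j =>
  ((hF.pd h.isOpen j).pd h.isOpen i).sub
    (ContDiffOn.sum fun k _ => (h.smooth_christoffel k i j).mul (hF.pd h.isOpen k))

theorem pd_hessian (h : IsMetricOn G U) (hF : ContDiffOn ℝ ∞ F U) (hx : x ∈ U) (a b c : Fin 4) :
    pd a (fun y => hessian G F y b c) x
      = pd a (pd b (pd c F)) x - ∑ k, pd a (fun y => christoffel G y k b c) x * pd k F x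
        - ∑ k, christoffel G x k b c * pd a (pd k F) x := by
  have hd : ∀ k, DifferentiableAt ℝ (fun y => christoffel G y k b c) x := fun k =>
    (h.smooth_christoffel k b c).differentiableAt_of_isOpen h.isOpen hx
  have hf : ∀ k, DifferentiableAt ℝ (pd k F) x := fun k =>
    (hF.pd h.isOpen k).differentiableAt_of_isOpen h.isOpen hx
  unfold hessian
  rw [pd_sub a (((hF.pd h.isOpen c).pd h.isOpen b).differentiableAt_of_isOpen h.isOpen hx)
    (DifferentiableAt.fun_sum fun k _ => (hd k).fun_mul (hf k)),
    pd_sum _ _ fun k _ => (hd k).fun_mul (hf k), sub_sub, ← Finset.sum_add_distrib]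
  congr 1
  exact Finset.sum_congr rfl fun k _ => pd_mul a (hd k) (hf k)

theorem covTwo_hessMat_apply (G : R4 → Matrix (Fin 4) (Fin 4) ℝ) (F : R4 → ℝ) (x : R4)
    (a b c : Fin 4) : covTwo G a (hessMat G F) x b c
      = pd a (fun y => hessian G F y b c) x - ∑ m, christoffel G x m a b * hessian G F x m c
        - ∑ m, hessian G F x b m * christoffel G x m a c := by
  simp [covTwo, matPd, hessMat, connMat, Matrix.mul_apply]

theorem sum_hessian_mul (G : R4 → Matrix (Fin 4) (Fin 4) ℝ) (F : R4 → ℝ) (x : R4)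
    (a : Fin 4) (t : Fin 4 → ℝ) : ∑ m, hessian G F x a m * t m
      = ∑ m, t m * pd a (pd m F) x - ∑ n, (∑ m, christoffel G x n a m * t m) * pd n F x := by
  unfold hessian
  simp only [sub_mul, Finset.sum_sub_distrib, Finset.sum_mul]
  refine congrArg₂ (· - ·) (Finset.sum_congr rfl fun m _ => mul_comm _ _) ?_
  rw [Finset.sum_comm]
  exact Finset.sum_congr rfl fun n _ => Finset.sum_congr rfl fun m _ => by ring

/-- The Ricci identity for the third covariant derivatives of a function. -/
theorem covTwo_hessMat_sub (h : IsMetricOn G U) (hF : ContDiffOn ℝ ∞ F U) (hx : x ∈ U)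
    (p i j : Fin 4) :
    covTwo G p (hessMat G F) x i j - covTwo G i (hessMat G F) x p j
      = -∑ n, curvatureUp G x n p i j * pd n F x := by
  rw [covTwo_hessMat_apply, covTwo_hessMat_apply, h.pd_hessian hF hx, h.pd_hessian hF hx,
    pd_comm h.isOpen (hF.pd h.isOpen j) hx p i]
  simp only [h.christoffel_symm hx _ i p, sum_hessian_mul]
  simp only [curvatureUp, add_mul, sub_mul, Finset.sum_add_distrib, Finset.sum_sub_distrib]
  ring

end IsMetricOn

end Connection

/-! ### Tensor algebra at a point and change of frame -/

section Frames

/-- The components in the frame `A` (whose `a`-th vector is the `a`-th column of `A`) of a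
2-tensor. -/
def pullTwo (A T : Matrix (Fin 4) (Fin 4) ℝ) : Matrix (Fin 4) (Fin 4) ℝ := A.transpose * T * A

/-- The components in the frame `A` of a 4-tensor. A 4-tensor `L` is encoded as the family of
matrices `L i j` that are obtained by fixing the first two indices. -/
def pullFour (A : Matrix (Fin 4) (Fin 4) ℝ) (L : Fin 4 → Fin 4 → Matrix (Fin 4) (Fin 4) ℝ)
    (a b : Fin 4) : Matrix (Fin 4) (Fin 4) ℝ :=
  Matrix.of fun c d => pullTwo A (Matrix.of fun i j => pullTwo A (L i j) c d) a b

/-- The full contraction `Xᵃᶜ Y_{ac}`. -/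
def matDot (X Y : Matrix (Fin 4) (Fin 4) ℝ) : ℝ := ∑ a, ∑ c, X a c * Y a c

/-- The contraction of the first and third indices of `L` with `h`. -/
def contractOf (h : Matrix (Fin 4) (Fin 4) ℝ) (L : Fin 4 → Fin 4 → Matrix (Fin 4) (Fin 4) ℝ) :
    Matrix (Fin 4) (Fin 4) ℝ :=
  Matrix.of fun j l => ∑ i, ∑ k, h i k * L i j k l

/-- The algebraic expression of the Weyl tensor by the metric `g`, the Riemann tensor `L`, the
Ricci tensor `P` and the scalar curvature `s`. -/
def weylOf (g : Matrix (Fin 4) (Fin 4) ℝ) (L : Fin 4 → Fin 4 → Matrix (Fin 4) (Fin 4) ℝ)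
    (P : Matrix (Fin 4) (Fin 4) ℝ) (s : ℝ) (i j : Fin 4) : Matrix (Fin 4) (Fin 4) ℝ :=
  Matrix.of fun k l => L i j k l
    - (1 / 2) * (P i k * g j l + P j l * g i k - P i l * g j k - P j k * g i l)
    + (s / 6) * (g i k * g j l - g i l * g j k)

/-- The Levi-Civita symbol as a 4-tensor. -/
def leviCivitaMat (i j : Fin 4) : Matrix (Fin 4) (Fin 4) ℝ :=
  Matrix.of fun k l => leviCivitaSymbol i j k l

/-- The tensor `ε_{ij}^{mn} W_{mnkl}`, with indices raised by `h`. -/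
def epsOf (h : Matrix (Fin 4) (Fin 4) ℝ) (W : Fin 4 → Fin 4 → Matrix (Fin 4) (Fin 4) ℝ)
    (i j : Fin 4) : Matrix (Fin 4) (Fin 4) ℝ :=
  Matrix.of fun k l =>
    matDot (leviCivitaMat i j) (h * (Matrix.of fun m n => W m n k l) * h.transpose)

section Pull

variable {A H h : Matrix (Fin 4) (Fin 4) ℝ}

theorem pullTwo_apply (A T : Matrix (Fin 4) (Fin 4) ℝ) (a b : Fin 4) :
    pullTwo A T a b = ∑ i, ∑ j, A i a * A j b * T i j := by
  simp only [pullTwo, Matrix.mul_apply, Matrix.transpose_apply, Finset.sum_mul]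
  rw [Finset.sum_comm]
  exact Finset.sum_congr rfl fun i _ => Finset.sum_congr rfl fun j _ => by ring

theorem pullTwo_sum {ι : Type*} (s : Finset ι) (A : Matrix (Fin 4) (Fin 4) ℝ)
    (T : ι → Matrix (Fin 4) (Fin 4) ℝ) : pullTwo A (∑ i ∈ s, T i) = ∑ i ∈ s, pullTwo A (T i) := by
  simp only [pullTwo, Finset.mul_sum, Finset.sum_mul]

theorem pullTwo_smul (c : ℝ) (A T : Matrix (Fin 4) (Fin 4) ℝ) :
    pullTwo A (c • T) = c • pullTwo A T := by
  simp [pullTwo]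

theorem pullTwo_add (A S T : Matrix (Fin 4) (Fin 4) ℝ) :
    pullTwo A (S + T) = pullTwo A S + pullTwo A T := by
  simp [pullTwo, mul_add, add_mul]

theorem pullTwo_neg (A T : Matrix (Fin 4) (Fin 4) ℝ) : pullTwo A (-T) = -pullTwo A T := by
  simp [pullTwo]

theorem pullTwo_sub (A S T : Matrix (Fin 4) (Fin 4) ℝ) :
    pullTwo A (S - T) = pullTwo A S - pullTwo A T := by
  simp [pullTwo, mul_sub, sub_mul]

theorem pullTwo_transpose (A T : Matrix (Fin 4) (Fin 4) ℝ) :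
    pullTwo A T.transpose = (pullTwo A T).transpose := by
  simp [pullTwo, mul_assoc]

/-- A 2-tensor is determined by its components in a frame. -/
theorem eq_zero_of_pullTwo (hA : IsUnit A.det) {T : Matrix (Fin 4) (Fin 4) ℝ}
    (h0 : pullTwo A T = 0) : T = 0 := by
  have hAt : IsUnit A.transpose.det := by rwa [Matrix.det_transpose]
  have h1 : (A.transpose)⁻¹ * (A.transpose * T * A) * A⁻¹ = 0 := by
    rw [show A.transpose * T * A = 0 from h0]
    simp
  rwa [mul_assoc, mul_assoc, mul_assoc, Matrix.mul_nonsing_inv _ hA, mul_one, ← mul_assoc,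
    Matrix.nonsing_inv_mul _ hAt, one_mul] at h1

theorem eq_zero_of_pullFour (hA : IsUnit A.det) {L : Fin 4 → Fin 4 → Matrix (Fin 4) (Fin 4) ℝ}
    (h0 : ∀ a b c d, pullFour A L a b c d = 0) (i j : Fin 4) : L i j = 0 := by
  refine eq_zero_of_pullTwo hA ?_
  ext c d
  have : (Matrix.of fun i j => pullTwo A (L i j) c d) = 0 := by
    refine eq_zero_of_pullTwo hA ?_
    ext a b
    exact h0 a b c d
  exact congrFun (congrFun this i) j

theorem matDot_eq_trace (X Y : Matrix (Fin 4) (Fin 4) ℝ) :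
    matDot X Y = (X.transpose * Y).trace := by
  simp only [matDot, Matrix.trace, Matrix.diag, Matrix.mul_apply, Matrix.transpose_apply]
  exact Finset.sum_comm

theorem matDot_pullTwo (A X Y : Matrix (Fin 4) (Fin 4) ℝ) :
    matDot X (pullTwo A Y) = matDot (A * X * A.transpose) Y := by
  rw [matDot_eq_trace, matDot_eq_trace, pullTwo]
  simp only [Matrix.transpose_mul, Matrix.transpose_transpose]
  rw [← mul_assoc, Matrix.trace_mul_comm]
  simp only [mul_assoc]

theorem pullTwo_matDot (A X Y : Matrix (Fin 4) (Fin 4) ℝ) :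
    matDot X (A * Y * A.transpose) = matDot (pullTwo A X) Y := by
  have := matDot_pullTwo A.transpose X Y
  simpa [pullTwo] using this

/-- The first and third indices can be pulled back last. -/
theorem pullFour_apply_swap (A : Matrix (Fin 4) (Fin 4) ℝ)
    (L : Fin 4 → Fin 4 → Matrix (Fin 4) (Fin 4) ℝ) (a b c d : Fin 4) :
    pullFour A L a b c d = pullTwo A (Matrix.of fun i k =>
      pullTwo A (Matrix.of fun j l => L i j k l) b d) a c := by
  simp only [pullFour, Matrix.of_apply, pullTwo_apply, Finset.mul_sum]
  refine Finset.sum_congr rfl fun i _ => ?_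
  rw [Finset.sum_comm]
  refine Finset.sum_congr rfl fun k _ => Finset.sum_congr rfl fun j _ =>
    Finset.sum_congr rfl fun l _ => by ring

theorem pullFour_transpose (A : Matrix (Fin 4) (Fin 4) ℝ)
    (L : Fin 4 → Fin 4 → Matrix (Fin 4) (Fin 4) ℝ) (a b : Fin 4) :
    pullFour A (fun i j => (L i j).transpose) a b = (pullFour A L a b).transpose := by
  ext c d
  simp only [pullFour, Matrix.of_apply, pullTwo_transpose, Matrix.transpose_apply]

theorem pullFour_smul (r : ℝ) (A : Matrix (Fin 4) (Fin 4) ℝ)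
    (L : Fin 4 → Fin 4 → Matrix (Fin 4) (Fin 4) ℝ) (a b : Fin 4) :
    pullFour A (fun i j => r • L i j) a b = r • pullFour A L a b := by
  ext c d
  simp only [pullFour, pullTwo_apply, Matrix.of_apply, Matrix.smul_apply, smul_eq_mul,
    Finset.mul_sum]
  exact Finset.sum_congr rfl fun i _ => Finset.sum_congr rfl fun j _ =>
    Finset.sum_congr rfl fun k _ => Finset.sum_congr rfl fun l _ => by ring

theorem pullFour_add (A : Matrix (Fin 4) (Fin 4) ℝ)
    (L L' : Fin 4 → Fin 4 → Matrix (Fin 4) (Fin 4) ℝ) (a b : Fin 4) :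
    pullFour A (fun i j => L i j + L' i j) a b = pullFour A L a b + pullFour A L' a b := by
  ext c d
  simp only [pullFour, pullTwo_apply, Matrix.of_apply, Matrix.add_apply, mul_add,
    Finset.sum_add_distrib]

theorem pullFour_sub (A : Matrix (Fin 4) (Fin 4) ℝ)
    (L L' : Fin 4 → Fin 4 → Matrix (Fin 4) (Fin 4) ℝ) (a b : Fin 4) :
    pullFour A (fun i j => L i j - L' i j) a b = pullFour A L a b - pullFour A L' a b := by
  ext c d
  simp only [pullFour, pullTwo_apply, Matrix.of_apply, Matrix.sub_apply, mul_sub,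
    Finset.sum_sub_distrib]

/-- The product `P_{ik} Q_{jl}` as a 4-tensor. -/
def tensorMat (P Q : Matrix (Fin 4) (Fin 4) ℝ) (i j : Fin 4) : Matrix (Fin 4) (Fin 4) ℝ :=
  Matrix.of fun k l => P i k * Q j l

theorem pullFour_tensorMat (A P Q : Matrix (Fin 4) (Fin 4) ℝ) (a b : Fin 4) :
    pullFour A (tensorMat P Q) a b = tensorMat (pullTwo A P) (pullTwo A Q) a b := by
  ext c d
  have h1 : ∀ i k, pullTwo A (Matrix.of fun j l => tensorMat P Q i j k l) b d
      = pullTwo A Q b d * P i k := by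
    intro i k
    have : (Matrix.of fun j l => tensorMat P Q i j k l) = P i k • Q := rfl
    rw [this, pullTwo_smul, Matrix.smul_apply, smul_eq_mul, mul_comm]
  have h2 : (Matrix.of fun i k => pullTwo A Q b d * P i k) = pullTwo A Q b d • P := rfl
  rw [pullFour_apply_swap]
  simp only [h1]
  rw [h2, pullTwo_smul, Matrix.smul_apply, smul_eq_mul, mul_comm]
  rfl

theorem weylOf_eq (g : Matrix (Fin 4) (Fin 4) ℝ) (L : Fin 4 → Fin 4 → Matrix (Fin 4) (Fin 4) ℝ)
    (P : Matrix (Fin 4) (Fin 4) ℝ) (s : ℝ) :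
    weylOf g L P s = fun i j => L i j
      - (1 / 2 : ℝ) • (tensorMat P g i j + tensorMat g P i j
        - ((tensorMat P g i j).transpose + (tensorMat g P i j).transpose))
      + (s / 6) • (tensorMat g g i j - (tensorMat g g i j).transpose) := by
  ext i j k l
  simp only [weylOf, tensorMat, Matrix.of_apply, Matrix.add_apply, Matrix.sub_apply,
    Matrix.smul_apply, Matrix.transpose_apply, smul_eq_mul]
  ring

theorem pullFour_weylOf (A g : Matrix (Fin 4) (Fin 4) ℝ)
    (L : Fin 4 → Fin 4 → Matrix (Fin 4) (Fin 4) ℝ) (P : Matrix (Fin 4) (Fin 4) ℝ) (s : ℝ) :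
    pullFour A (weylOf g L P s) = weylOf (pullTwo A g) (pullFour A L) (pullTwo A P) s := by
  funext a b
  simp only [weylOf_eq, pullFour_add, pullFour_sub, pullFour_smul, pullFour_transpose,
    pullFour_tensorMat]

theorem contractOf_pullFour (hH : A * H * A.transpose = h)
    (L : Fin 4 → Fin 4 → Matrix (Fin 4) (Fin 4) ℝ) :
    contractOf H (pullFour A L) = pullTwo A (contractOf h L) := by
  ext b d
  have h1 : contractOf H (pullFour A L) b d
      = matDot H (pullTwo A (Matrix.of fun i k =>
        pullTwo A (Matrix.of fun j l => L i j k l) b d)) := by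
    simp only [contractOf, matDot, Matrix.of_apply, pullFour_apply_swap]
  have h2 : contractOf h L = ∑ i, ∑ k, h i k • Matrix.of fun j l => L i j k l := by
    ext j l
    simp [contractOf, Matrix.sum_apply]
  rw [h1, matDot_pullTwo, hH, h2]
  simp only [matDot, pullTwo_sum, pullTwo_smul, Matrix.sum_apply, Matrix.smul_apply, smul_eq_mul,
    Matrix.of_apply]

theorem leviCivitaSymbol_eq_det (i j k l : Fin 4) : leviCivitaSymbol i j k l
    = (Matrix.of fun a b : Fin 4 => if ![i, j, k, l] a = b then (1 : ℝ) else 0).det := by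
  unfold leviCivitaSymbol
  refine ((Int.castRingHom ℝ).map_det _).trans ?_
  congr 1
  ext a b
  simp [Matrix.map_apply, apply_ite]

theorem sum_fin_succ_arrow {n : ℕ} (φ : (Fin (n + 1) → Fin 4) → ℝ) :
    ∑ w, φ w = ∑ i, ∑ w, φ (Matrix.vecCons i w) := by
  rw [← Fintype.sum_prod_type' (f := fun i w => φ (Matrix.vecCons i w))]
  exact (Fintype.sum_equiv (Fin.consEquiv fun _ : Fin (n + 1) => Fin 4) _ _ fun z => rfl).symm

theorem sum_fin_four_arrow (φ : (Fin 4 → Fin 4) → ℝ) :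
    ∑ w, φ w = ∑ i, ∑ j, ∑ k, ∑ l, φ ![i, j, k, l] := by
  simp only [sum_fin_succ_arrow, Finset.univ_unique, Finset.sum_singleton]
  refine Finset.sum_congr rfl fun i _ => Finset.sum_congr rfl fun j _ =>
    Finset.sum_congr rfl fun k _ => Finset.sum_congr rfl fun l _ => ?_
  congr

/-- The Levi-Civita symbol is multiplied by the determinant under a change of frame. -/
theorem pullFour_leviCivitaMat (A : Matrix (Fin 4) (Fin 4) ℝ) (a b : Fin 4) :
    pullFour A leviCivitaMat a b = A.det • leviCivitaMat a b := by
  ext c d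
  have h1 : pullFour A leviCivitaMat a b c d
      = ∑ w : Fin 4 → Fin 4, (∏ r, A (w r) (![a, b, c, d] r)) *
        (Matrix.of fun r s : Fin 4 => if w r = s then (1 : ℝ) else 0).det := by
    rw [sum_fin_four_arrow]
    simp only [pullFour, pullTwo_apply, leviCivitaMat, Matrix.of_apply, leviCivitaSymbol_eq_det,
      Finset.mul_sum, Fin.prod_univ_four]
    refine Finset.sum_congr rfl fun i _ => Finset.sum_congr rfl fun j _ =>
      Finset.sum_congr rfl fun k _ => Finset.sum_congr rfl fun l _ => ?_
    simp
    ring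
  have h2 : (∑ w : Fin 4 → Fin 4, (∏ r, A (w r) (![a, b, c, d] r)) *
        (Matrix.of fun r s : Fin 4 => if w r = s then (1 : ℝ) else 0).det)
      = (Matrix.of fun r s : Fin 4 => A s (![a, b, c, d] r)).det := by
    have := (Matrix.detRowAlternating (R := ℝ) (n := Fin 4)).toMultilinearMap.map_sum
      (fun r (i : Fin 4) => A i (![a, b, c, d] r) • (fun s : Fin 4 => if i = s then (1 : ℝ) else 0))
    have h3 : (fun r : Fin 4 => ∑ i : Fin 4, A i (![a, b, c, d] r) •
        (fun s : Fin 4 => if i = s then (1 : ℝ) else 0))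
        = fun r s : Fin 4 => A s (![a, b, c, d] r) := by
      funext r s
      simp [Finset.sum_apply]
    rw [h3] at this
    refine Eq.trans ?_ this.symm
    refine Finset.sum_congr rfl fun w _ => ?_
    rw [MultilinearMap.map_smul_univ]
    rfl
  have h4 : (Matrix.of fun r s : Fin 4 => A s (![a, b, c, d] r))
      = (Matrix.of fun r s : Fin 4 => if ![a, b, c, d] r = s then (1 : ℝ) else 0)
        * A.transpose := by
    ext r s
    simp [Matrix.mul_apply]
  rw [h1, h2, h4, Matrix.det_mul, Matrix.det_transpose, ← leviCivitaSymbol_eq_det]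
  simp [leviCivitaMat, mul_comm]

theorem pullFour_epsOf (hH : A * H * A.transpose = h)
    (W : Fin 4 → Fin 4 → Matrix (Fin 4) (Fin 4) ℝ) (a b : Fin 4) :
    pullFour A (epsOf h W) a b = A.det • epsOf H (pullFour A W) a b := by
  ext c d
  set Y : Matrix (Fin 4) (Fin 4) ℝ := Matrix.of fun m n => pullTwo A (W m n) c d with hY
  -- Pull back the last two indices, which the contraction does not touch.
  have h1 : ∀ i j, pullTwo A (epsOf h W i j) c d
      = matDot (leviCivitaMat i j) (h * Y * h.transpose) := by
    intro i j
    simp only [epsOf, hY, matDot, pullTwo_apply, Matrix.of_apply, Matrix.mul_apply,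
      Matrix.transpose_apply, Finset.mul_sum, Finset.sum_mul]
    have e1 : ∀ T : Fin 4 → Fin 4 → Fin 4 → Fin 4 → Fin 4 → Fin 4 → ℝ,
        ∑ k, ∑ l, ∑ e, ∑ f, ∑ n, ∑ m, T k l e f n m
          = ∑ e, ∑ f, ∑ n, ∑ m, ∑ k, ∑ l, T k l e f n m := by
      intro T
      simp only [← Fintype.sum_prod_type']
      refine Fintype.sum_equiv ⟨fun z => (z.2.2.1, z.2.2.2.1, z.2.2.2.2.1, z.2.2.2.2.2, z.1, z.2.1),
        fun z => (z.2.2.2.2.1, z.2.2.2.2.2, z.1, z.2.1, z.2.2.1, z.2.2.2.1), fun _ => rfl,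
        fun _ => rfl⟩ _ _ fun z => rfl
    rw [e1]
    exact Finset.sum_congr rfl fun _ _ => Finset.sum_congr rfl fun _ _ =>
      Finset.sum_congr rfl fun _ _ => Finset.sum_congr rfl fun _ _ =>
      Finset.sum_congr rfl fun _ _ => Finset.sum_congr rfl fun _ _ => by ring
  have h2 : h * Y * h.transpose = A * (H * pullTwo A Y * H.transpose) * A.transpose := by
    rw [← hH]
    simp only [pullTwo, Matrix.transpose_mul, Matrix.transpose_transpose, mul_assoc]
  have h3 : pullFour A (epsOf h W) a b c d
      = matDot (pullFour A leviCivitaMat a b) (H * pullTwo A Y * H.transpose) := by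
    set Z := H * pullTwo A Y * H.transpose
    have : pullFour A (epsOf h W) a b c d
        = ∑ i, ∑ j, A i a * A j b * matDot (pullTwo A (leviCivitaMat i j)) Z := by
      simp only [pullFour, Matrix.of_apply, h1, h2, pullTwo_matDot]
      rw [pullTwo_apply]
      rfl
    rw [this]
    simp only [matDot, pullFour, Matrix.of_apply, Finset.mul_sum]
    have e2 : ∀ T : Fin 4 → Fin 4 → Fin 4 → Fin 4 → ℝ,
        ∑ i, ∑ j, ∑ e, ∑ f, T i j e f = ∑ e, ∑ f, ∑ i, ∑ j, T i j e f := by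
      intro T
      simp only [← Fintype.sum_prod_type']
      exact Fintype.sum_equiv ⟨fun z => (z.2.2.1, z.2.2.2, z.1, z.2.1),
        fun z => (z.2.2.1, z.2.2.2, z.1, z.2.1), fun _ => rfl, fun _ => rfl⟩ _ _ fun z => rfl
    rw [e2]
    refine Finset.sum_congr rfl fun e _ => Finset.sum_congr rfl fun f _ => ?_
    rw [pullTwo_apply A (Matrix.of fun i j => pullTwo A (leviCivitaMat i j) e f)]
    simp only [Finset.sum_mul, Matrix.of_apply]
    exact Finset.sum_congr rfl fun _ _ => Finset.sum_congr rfl fun _ _ => by ring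
  rw [h3, pullFour_leviCivitaMat]
  simp only [matDot, epsOf, Matrix.smul_apply, smul_eq_mul, Matrix.of_apply, Finset.mul_sum]
  refine Finset.sum_congr rfl fun _ _ => Finset.sum_congr rfl fun _ _ => ?_
  rw [mul_assoc]
  rfl

end Pull

theorem weylPlus_eq (s : ℝ) (G : R4 → Matrix (Fin 4) (Fin 4) ℝ) (x : R4) (i j k l : Fin 4) :
    weylPlus s G x i j k l = (1 / 2) * (weyl G x i j k l + (1 / 2) * (s * Real.sqrt (G x).det)
      * epsOf (G x)⁻¹ (fun i j => Matrix.of (weyl G x i j)) i j k l) := by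
  unfold weylPlus starWeyl volumeForm
  congr 2
  rw [mul_assoc]
  congr 1
  simp only [epsOf, matDot, leviCivitaMat, Matrix.of_apply, Matrix.mul_apply,
    Matrix.transpose_apply, Finset.mul_sum, Finset.sum_mul]
  have e : ∀ T : Fin 4 → Fin 4 → Fin 4 → Fin 4 → ℝ,
      ∑ m, ∑ n, ∑ a, ∑ b, T m n a b = ∑ a, ∑ b, ∑ n, ∑ m, T m n a b := by
    intro T
    simp only [← Fintype.sum_prod_type']
    exact Fintype.sum_equiv ⟨fun z => (z.2.2.1, z.2.2.2, z.2.1, z.1),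
      fun z => (z.2.2.2, z.2.2.1, z.1, z.2.1), fun _ => rfl, fun _ => rfl⟩ _ _ fun z => rfl
  rw [e]
  exact Finset.sum_congr rfl fun _ _ => Finset.sum_congr rfl fun _ _ =>
      Finset.sum_congr rfl fun _ _ => Finset.sum_congr rfl fun _ _ => by ring

end Frames

/-! ### Curvature algebra in an orthonormal frame -/

section FrameAlgebra

/-- `W_{abkl} = -σ (⋆W)_{abkl}` for the six pairs of frame vectors: `W` is anti-self-dual if `σ = 1`
and self-dual if `σ = -1`. -/
structure DualPairs (σ : ℝ) (W : Fin 4 → Fin 4 → Matrix (Fin 4) (Fin 4) ℝ) : Prop where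
  h01 : ∀ k l, W 0 1 k l + σ * W 2 3 k l = 0
  h02 : ∀ k l, W 0 2 k l - σ * W 1 3 k l = 0
  h03 : ∀ k l, W 0 3 k l + σ * W 1 2 k l = 0
  h12 : ∀ k l, W 1 2 k l + σ * W 0 3 k l = 0
  h13 : ∀ k l, W 1 3 k l - σ * W 0 2 k l = 0
  h23 : ∀ k l, W 2 3 k l + σ * W 0 1 k l = 0

theorem epsOf_one (W : Fin 4 → Fin 4 → Matrix (Fin 4) (Fin 4) ℝ) (a b k l : Fin 4) :
    epsOf 1 W a b k l = ∑ m, ∑ n, leviCivitaSymbol a b m n * W m n k l := by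
  simp [epsOf, matDot, leviCivitaMat]

theorem sum_leviCivitaSymbol {W : Fin 4 → Fin 4 → ℝ} (hW : ∀ m n, W m n = -W n m)
    {a b c d : Fin 4} (h : ∀ m n, (Matrix.of fun r s : Fin 4 =>
      if ![a, b, m, n] r = s then (1 : ℤ) else 0).det
        = (if m = c ∧ n = d then 1 else 0) - if m = d ∧ n = c then 1 else 0) :
    ∑ m, ∑ n, leviCivitaSymbol a b m n * W m n = 2 * W c d := by
  have h1 : ∀ m n, leviCivitaSymbol a b m n * W m n
      = (if m = c then if n = d then W m n else 0 else 0)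
        - if m = d then if n = c then W m n else 0 else 0 := by
    intro m n
    rw [leviCivitaSymbol, h m n]
    simp only [ite_and]
    push_cast
    split_ifs <;> ring
  simp only [h1, Finset.sum_sub_distrib]
  simp
  rw [hW d c]
  ring

theorem dualPairs_of_epsOf {σ : ℝ} {W : Fin 4 → Fin 4 → Matrix (Fin 4) (Fin 4) ℝ}
    (hW : ∀ m n k l, W m n k l = -W n m k l)
    (h : ∀ a b k l, W a b k l + 1 / 2 * σ * epsOf 1 W a b k l = 0) : DualPairs σ W := by
  have key : ∀ a b c d : Fin 4, (∀ m n, (Matrix.of fun r s : Fin 4 =>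
      if ![a, b, m, n] r = s then (1 : ℤ) else 0).det
        = (if m = c ∧ n = d then 1 else 0) - if m = d ∧ n = c then 1 else 0) →
      ∀ k l, W a b k l + σ * W c d k l = 0 := by
    intro a b c d hd k l
    have h1 := h a b k l
    rw [epsOf_one, sum_leviCivitaSymbol (W := fun m n => W m n k l) (fun m n => hW m n k l) hd]
      at h1
    linarith
  refine ⟨key 0 1 2 3 ?_, fun k l => ?_, key 0 3 1 2 ?_, key 1 2 0 3 ?_, fun k l => ?_,
    key 2 3 0 1 ?_⟩
  · decide
  · have := key 0 2 3 1 (by decide) k l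
    rw [hW 3 1 k l] at this
    linarith
  · decide
  · decide
  · have := key 1 3 2 0 (by decide) k l
    rw [hW 2 0 k l] at this
    linarith
  · decide

/-- The values at a point, in an orthonormal frame `e` whose first vector `e₀` is `∇f / |∇f|`, of the
curvature of a gradient Ricci soliton and of its first covariant derivatives. Here `R` is the
Riemann tensor, `P` the Ricci tensor, `S` the scalar curvature, `φ = |∇f|`, and the prefix `D`
denotes covariant derivatives, the first index being that of the direction. -/
structure SolitonFrame (φ : ℝ) (R : Fin 4 → Fin 4 → Matrix (Fin 4) (Fin 4) ℝ)
    (DR : Fin 4 → Fin 4 → Fin 4 → Matrix (Fin 4) (Fin 4) ℝ) (P : Matrix (Fin 4) (Fin 4) ℝ)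
    (DP : Fin 4 → Matrix (Fin 4) (Fin 4) ℝ) (S : ℝ) (DS : Fin 4 → ℝ) : Prop where
  ne_zero : φ ≠ 0
  antisymm : ∀ a b c d, R a b c d = -R b a c d
  antisymm' : ∀ a b c d, R a b c d = -R a b d c
  bianchi : ∀ a b c d, R a b c d + R b d c a + R d a c b = 0
  ricci : ∀ b d, P b d = ∑ a, R a b a d
  scalar : S = ∑ b, P b b
  d_antisymm : ∀ e a b c d, DR e a b c d = -DR e b a c d
  d_antisymm' : ∀ e a b c d, DR e a b c d = -DR e a b d c
  d_bianchi : ∀ e a b c d, DR e a b c d + DR a b e c d + DR b e a c d = 0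
  d_ricci : ∀ e b d, DP e b d = ∑ a, DR e a b a d
  d_ricci_symm : ∀ e b d, DP e b d = DP e d b
  d_scalar : ∀ e, DS e = ∑ b, DP e b b
  soliton : ∀ a b d, DP a b d - DP b a d = φ * R a b 0 d

namespace SolitonFrame

variable {φ : ℝ} {R : Fin 4 → Fin 4 → Matrix (Fin 4) (Fin 4) ℝ}
  {DR : Fin 4 → Fin 4 → Fin 4 → Matrix (Fin 4) (Fin 4) ℝ} {P : Matrix (Fin 4) (Fin 4) ℝ}
  {DP : Fin 4 → Matrix (Fin 4) (Fin 4) ℝ} {S : ℝ} {DS : Fin 4 → ℝ} {σ : ℝ}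

theorem pair_symm (h : SolitonFrame φ R DR P DP S DS) (a b c d : Fin 4) :
    R a b c d = R c d a b := by
  have h1 := h.bianchi a b c d
  have h2 := h.bianchi b c d a
  have h3 := h.bianchi c d a b
  have h4 := h.bianchi d a b c
  have e := h.antisymm
  have e' := h.antisymm'
  linarith [e a b c d, e' a b c d, e b d c a, e' b d c a, e d a c b, e' d a c b,
    e b c d a, e' b c d a, e c a d b, e' c a d b, e a b d c, e' a b d c,
    e c d a b, e' c d a b, e d b a c, e' d b a c, e b c a d, e' b c a d,
    e d a b c, e' d a b c, e a c b d, e' a c b d, e c d b a, e' c d b a,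
    e c a b d, e b d a c]

theorem ricci_symm (h : SolitonFrame φ R DR P DP S DS) (b d : Fin 4) : P b d = P d b := by
  rw [h.ricci, h.ricci]
  exact Finset.sum_congr rfl fun a _ => h.pair_symm a b a d

/-- The contracted second Bianchi identity. -/
theorem div_riemann (h : SolitonFrame φ R DR P DP S DS) (a b d : Fin 4) :
    ∑ c, DR c a b c d = φ * R a b 0 d := by
  rw [← h.soliton, h.d_ricci, h.d_ricci, ← Finset.sum_sub_distrib]
  refine Finset.sum_congr rfl fun c _ => ?_
  have h1 := h.d_bianchi c a b c d
  have h2 := h.d_antisymm a b c c d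
  linarith

theorem div_ricci (h : SolitonFrame φ R DR P DP S DS) (b : Fin 4) :
    ∑ c, DP c c b = (1 / 2) * DS b := by
  have h1 : ∑ a, ∑ c, DR c a b c a = -∑ c, DP c b c := by
    rw [Finset.sum_comm, ← Finset.sum_neg_distrib]
    refine Finset.sum_congr rfl fun c _ => ?_
    rw [h.d_ricci, ← Finset.sum_neg_distrib]
    exact Finset.sum_congr rfl fun a _ => h.d_antisymm' c a b c a
  have h2 : ∑ a, ∑ c, DR c a b c a = ∑ a, DP a b a - ∑ a, DP b a a := by
    rw [← Finset.sum_sub_distrib]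
    refine Finset.sum_congr rfl fun a _ => ?_
    rw [h.div_riemann, h.soliton]
  have h3 : ∑ c, DP c c b = ∑ c, DP c b c := Finset.sum_congr rfl fun c _ => h.d_ricci_symm c c b
  have h4 := h.d_scalar b
  linarith

/-- `∇S = 2 Ric(∇f)`. -/
theorem d_scalar_eq (h : SolitonFrame φ R DR P DP S DS) (a : Fin 4) :
    DS a = 2 * φ * P a 0 := by
  have h1 : ∑ b, φ * R a b 0 b = φ * P a 0 := by
    rw [h.ricci, Finset.mul_sum]
    refine Finset.sum_congr rfl fun b _ => ?_
    rw [h.antisymm a b 0 b, h.antisymm' b a 0 b, neg_neg]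
  have h2 : ∑ b, φ * R a b 0 b = DS a - ∑ b, DP b b a := by
    rw [h.d_scalar, ← Finset.sum_sub_distrib]
    refine Finset.sum_congr rfl fun b _ => ?_
    rw [← h.soliton, h.d_ricci_symm b a b]
  rw [h.div_ricci] at h2
  linarith

/-- The divergence of the Weyl tensor is algebraic in the curvature and `∇f`: the first derivatives
are eliminated by the contracted Bianchi identities and the soliton equation. -/
theorem div_weyl (h : SolitonFrame φ R DR P DP S DS) (a b d : Fin 4) :
    ∑ c, weylOf 1 (DR c) (DP c) (DS c) a b c d = φ / 2 * (R a b 0 d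
      - (1 / 3) * (P a 0 * (1 : Matrix (Fin 4) (Fin 4) ℝ) b d
        - P b 0 * (1 : Matrix (Fin 4) (Fin 4) ℝ) a d)) := by
  have h1 : ∀ c, weylOf 1 (DR c) (DP c) (DS c) a b c d = DR c a b c d
      - (1 / 2) * (DP c c a * (1 : Matrix (Fin 4) (Fin 4) ℝ) b d
        + (1 : Matrix (Fin 4) (Fin 4) ℝ) a c * DP c b d
        - (1 : Matrix (Fin 4) (Fin 4) ℝ) b c * DP c a d
        - DP c c b * (1 : Matrix (Fin 4) (Fin 4) ℝ) a d)
      + (1 / 6) * ((1 : Matrix (Fin 4) (Fin 4) ℝ) a c * DS c * (1 : Matrix (Fin 4) (Fin 4) ℝ) b d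
        - (1 : Matrix (Fin 4) (Fin 4) ℝ) b c * DS c * (1 : Matrix (Fin 4) (Fin 4) ℝ) a d) := by
    intro c
    simp only [weylOf, Matrix.of_apply]
    rw [h.d_ricci_symm c a c, h.d_ricci_symm c b c]
    ring
  have h2 : ∀ (i : Fin 4) (t : Fin 4 → ℝ), ∑ c, (1 : Matrix (Fin 4) (Fin 4) ℝ) i c * t c = t i := by
    intro i t
    simp [Matrix.one_apply]
  simp only [h1, Finset.sum_add_distrib, Finset.sum_sub_distrib, ← Finset.mul_sum,
    ← Finset.sum_mul, h2, h.div_ricci, h.div_riemann]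
  have h3 := h.soliton a b d
  rw [h.d_scalar_eq, h.d_scalar_eq]
  linear_combination (-(1 : ℝ) / 2) * h3

/-- The Ricci tensor splits along `∇f`. By `div_weyl`, the difference of `div W` and
`(φ / 2) W(·, ·, e₀, ·)` is algebraic in the Ricci tensor, and it inherits the duality relation of
`W`. Its components with the index pair orthogonal to `e₀` only involve `Ric(e₀, ·)`. -/
theorem ricci_split (h : SolitonFrame φ R DR P DP S DS) (hW : DualPairs σ (weylOf 1 R P S))
    (hDW : ∀ e, DualPairs σ (weylOf 1 (DR e) (DP e) (DS e))) :
    ∃ μ : ℝ, ∀ a b, P a b = μ * (1 : Matrix (Fin 4) (Fin 4) ℝ) a b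
      + (P 0 0 - μ) * ((1 : Matrix (Fin 4) (Fin 4) ℝ) 0 a * (1 : Matrix (Fin 4) (Fin 4) ℝ) 0 b) := by
  have hφ : φ / 2 ≠ 0 := div_ne_zero h.ne_zero two_ne_zero
  have key : ∀ (τ : ℝ) (a b a' b' : Fin 4),
      (∀ k l, weylOf 1 R P S a b k l + τ * weylOf 1 R P S a' b' k l = 0) →
      (∀ e k l, weylOf 1 (DR e) (DP e) (DS e) a b k l
        + τ * weylOf 1 (DR e) (DP e) (DS e) a' b' k l = 0) → ∀ d,
      (R a b 0 d - (1 / 3) * (P a 0 * (1 : Matrix (Fin 4) (Fin 4) ℝ) b d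
        - P b 0 * (1 : Matrix (Fin 4) (Fin 4) ℝ) a d) - weylOf 1 R P S a b 0 d)
      + τ * (R a' b' 0 d - (1 / 3) * (P a' 0 * (1 : Matrix (Fin 4) (Fin 4) ℝ) b' d
        - P b' 0 * (1 : Matrix (Fin 4) (Fin 4) ℝ) a' d) - weylOf 1 R P S a' b' 0 d) = 0 := by
    intro τ a b a' b' h1 h2 d
    have h3 : ∑ c, (weylOf 1 (DR c) (DP c) (DS c) a b c d
        + τ * weylOf 1 (DR c) (DP c) (DS c) a' b' c d) = 0 :=
      Finset.sum_eq_zero fun c _ => h2 c c d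
    rw [Finset.sum_add_distrib, ← Finset.mul_sum, h.div_weyl, h.div_weyl] at h3
    have h4 := h1 0 d
    refine mul_left_cancel₀ hφ ?_
    linear_combination h3 - φ / 2 * h4
  have k01 := key σ 0 1 2 3 hW.h01 fun e => (hDW e).h01
  have k02 := key (-σ) 0 2 1 3 (fun k l => by linarith [hW.h02 k l])
    fun e k l => by linarith [(hDW e).h02 k l]
  have k03 := key σ 0 3 1 2 hW.h03 fun e => (hDW e).h03
  simp only [weylOf, Matrix.of_apply] at k01 k02 k03
  have s := h.ricci_symm
  -- The last index `0` kills the contribution of the dual pair and gives `P a 0 = 0`; after that,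
  -- the dual pair, which contributes multiples of the `P a 0`, drops out for the other values too.
  have p1 : P 1 0 = 0 := by
    have := k01 0
    simp at this
    linarith [s 0 1]
  have p2 : P 2 0 = 0 := by
    have := k02 0
    simp at this
    linarith [s 0 2]
  have p3 : P 3 0 = 0 := by
    have := k03 0
    simp at this
    linarith [s 0 3]
  have q1 := k01 1
  have q12 := k01 2
  have q13 := k01 3
  have q2 := k02 2
  have q23 := k02 3
  have q3 := k03 3
  simp [p1, p2, p3] at q1 q12 q13 q2 q23 q3
  have hS := h.scalar
  simp only [Fin.sum_univ_four] at hS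
  refine ⟨P 1 1, fun a b => ?_⟩
  fin_cases a <;> fin_cases b <;> simp [Matrix.one_apply] <;>
    linarith [s 0 1, s 0 2, s 0 3, s 1 2, s 1 3, s 2 3]

/-- If moreover the covariant derivative of the Ricci tensor in directions orthogonal to `∇f` is
pure trace on the orthogonal complement of `∇f`, then the Weyl tensor vanishes. -/
theorem weyl_eq_zero (h : SolitonFrame φ R DR P DP S DS) (hW : DualPairs σ (weylOf 1 R P S))
    (hP : ∀ a, a ≠ 0 → P a 0 = 0) (m : Fin 4 → ℝ)
    (hDP : ∀ e b d, e ≠ 0 → b ≠ 0 → d ≠ 0 → DP e b d = m e * (1 : Matrix (Fin 4) (Fin 4) ℝ) b d)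
    (a b c d : Fin 4) : weylOf 1 R P S a b c d = 0 := by
  have h0 : ∀ a b d, a ≠ 0 → b ≠ 0 → d ≠ 0 → φ * R a b 0 d
      = m a * (1 : Matrix (Fin 4) (Fin 4) ℝ) b d - m b * (1 : Matrix (Fin 4) (Fin 4) ℝ) a d := by
    intro a b d ha hb hd
    rw [← h.soliton, hDP a b d ha hb hd, hDP b a d hb ha hd]
  -- The trace of `h0` over the orthogonal complement of `∇f` is `φ * P a 0 = 2 * m a`.
  have hm : ∀ a, a ≠ 0 → m a = 0 := by
    intro a ha
    have h1 : φ * P a 0 = ∑ b, φ * R a b 0 b := by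
      rw [h.ricci, Finset.mul_sum]
      refine Finset.sum_congr rfl fun b _ => ?_
      rw [h.antisymm a b 0 b, h.antisymm' b a 0 b, neg_neg]
    have h2 : R a 0 0 0 = 0 := by linarith [h.antisymm' a 0 0 0]
    rw [hP a ha, Fin.sum_univ_four, h2, h0 a 1 1 ha (by decide) (by decide),
      h0 a 2 2 ha (by decide) (by decide), h0 a 3 3 ha (by decide) (by decide)] at h1
    fin_cases a <;> simp [Matrix.one_apply] at h1 ha ⊢ <;> linarith
  have hR : ∀ a b d, a ≠ 0 → b ≠ 0 → d ≠ 0 → R a b 0 d = 0 := by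
    intro a b d ha hb hd
    have h1 := h0 a b d ha hb hd
    rw [hm a ha, hm b hb, zero_mul, zero_mul, sub_zero] at h1
    exact (mul_eq_zero.1 h1).resolve_left h.ne_zero
  set W := weylOf 1 R P S with hWdef
  have hW1 : ∀ a b d, a ≠ 0 → b ≠ 0 → d ≠ 0 → W a b 0 d = 0 := by
    intro a b d ha hb hd
    simp [hWdef, weylOf, hR a b d ha hb hd, hP a ha, hP b hb, Matrix.one_apply, ha, hb]
  have as1 : ∀ a b c d, W a b c d = -W b a c d := by
    intro a b c d
    simp only [hWdef, weylOf, Matrix.of_apply]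
    linarith [h.antisymm a b c d]
  have as2 : ∀ a b c d, W a b c d = -W a b d c := by
    intro a b c d
    simp only [hWdef, weylOf, Matrix.of_apply]
    linarith [h.antisymm' a b c d]
  have ps : ∀ a b c d, W a b c d = W c d a b := by
    intro a b c d
    have o : ∀ i j, (1 : Matrix (Fin 4) (Fin 4) ℝ) i j = (1 : Matrix (Fin 4) (Fin 4) ℝ) j i := by
      intro i j
      simp [Matrix.one_apply, eq_comm]
    simp only [hWdef, weylOf, Matrix.of_apply]
    rw [h.pair_symm a b c d, h.ricci_symm a c, h.ricci_symm b d, h.ricci_symm a d,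
      h.ricci_symm b c, o a c, o b d, o a d, o b c]
    ring
  -- Duality trades a pair orthogonal to `e₀` for a pair that contains `e₀`.
  have hW2 : ∀ a d, a ≠ 0 → d ≠ 0 → W 0 a 0 d = 0 := by
    intro a d ha hd
    have e1 := hW.h01 0 d
    have e2 := hW.h02 0 d
    have e3 := hW.h03 0 d
    rw [hW1 2 3 d (by decide) (by decide) hd] at e1
    rw [hW1 1 3 d (by decide) (by decide) hd] at e2
    rw [hW1 1 2 d (by decide) (by decide) hd] at e3
    fin_cases a <;> simp at ha e1 e2 e3 ⊢ <;> assumption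
  have hW3 : ∀ a b d, W a b 0 d = 0 := by
    intro a b d
    by_cases hd : d = 0
    · subst hd
      linarith [as2 a b 0 0]
    by_cases ha : a = 0
    · by_cases hb : b = 0
      · subst ha hb
        linarith [as1 0 0 0 d]
      · subst ha
        exact hW2 b d hb hd
    · by_cases hb : b = 0
      · subst hb
        rw [as1, hW2 a d ha hd, neg_zero]
      · exact hW1 a b d ha hb hd
  have hW4 : ∀ a c d, W 0 a c d = 0 := fun a c d => by rw [ps, hW3]
  have z : ∀ a k l, W a a k l = 0 := fun a k l => by linarith [as1 a a k l]
  have e12 := hW.h12 c d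
  have e13 := hW.h13 c d
  have e23 := hW.h23 c d
  rw [hW4] at e12 e13 e23
  simp only [mul_zero, add_zero, sub_zero] at e12 e13 e23
  fin_cases a <;> fin_cases b <;>
    first
    | exact hW4 _ _ _
    | exact z _ _ _
    | assumption
    | (rw [as1, neg_eq_zero]; first | exact hW4 _ _ _ | assumption)

end SolitonFrame

end FrameAlgebra

/-! ### Frames that are parallel to first order at a point -/

/-- The frame field with value `A₀` at `x₀` whose vectors, in the coordinates `y`, are affine
functions of `y` and have vanishing covariant derivatives at `x₀`. -/
def parallelFrame (G : R4 → Matrix (Fin 4) (Fin 4) ℝ) (x₀ : R4) (A₀ : Matrix (Fin 4) (Fin 4) ℝ)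
    (y : R4) : Matrix (Fin 4) (Fin 4) ℝ :=
  (1 - ∑ p, (y p - x₀ p) • connMat G p x₀) * A₀

section ParallelFrame

variable {G : R4 → Matrix (Fin 4) (Fin 4) ℝ} {x x₀ : R4} {A₀ : Matrix (Fin 4) (Fin 4) ℝ}
  {A T : R4 → Matrix (Fin 4) (Fin 4) ℝ} {U : Set R4}
  {L : R4 → Fin 4 → Fin 4 → Matrix (Fin 4) (Fin 4) ℝ}

theorem parallelFrame_self (G : R4 → Matrix (Fin 4) (Fin 4) ℝ) (x₀ : R4)
    (A₀ : Matrix (Fin 4) (Fin 4) ℝ) : parallelFrame G x₀ A₀ x₀ = A₀ := by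
  simp [parallelFrame]

theorem parallelFrame_factor_apply (G : R4 → Matrix (Fin 4) (Fin 4) ℝ) (x₀ y : R4) (i j : Fin 4) :
    (1 - ∑ p, (y p - x₀ p) • connMat G p x₀) i j
      = (1 : Matrix (Fin 4) (Fin 4) ℝ) i j - ∑ p, (y p - x₀ p) * connMat G p x₀ i j := by
  simp [Matrix.sub_apply, Matrix.sum_apply, Matrix.smul_apply]

theorem smooth_coord (p : Fin 4) : ContDiff ℝ ∞ fun y : R4 => y p :=
  (EuclideanSpace.proj p : R4 →L[ℝ] ℝ).contDiff

theorem smooth_parallelFrame_factor (G : R4 → Matrix (Fin 4) (Fin 4) ℝ) (x₀ : R4) (U : Set R4) :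
    MatSmoothOn (fun y => 1 - ∑ p, (y p - x₀ p) • connMat G p x₀) U := by
  intro i j
  simp only [parallelFrame_factor_apply]
  exact contDiffOn_const.sub (ContDiffOn.sum fun p _ =>
    ((smooth_coord p).contDiffOn.sub contDiffOn_const).mul contDiffOn_const)

theorem smooth_parallelFrame (G : R4 → Matrix (Fin 4) (Fin 4) ℝ) (x₀ : R4)
    (A₀ : Matrix (Fin 4) (Fin 4) ℝ) (U : Set R4) : MatSmoothOn (parallelFrame G x₀ A₀) U :=
  (smooth_parallelFrame_factor G x₀ U).mul fun _ _ => contDiffOn_const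

theorem pd_coord (p q : Fin 4) (x : R4) : pd p (fun y => y q) x = if p = q then 1 else 0 := by
  have h : (fun y : R4 => y q) = (EuclideanSpace.proj q : R4 →L[ℝ] ℝ) := rfl
  rw [pd, h, ContinuousLinearMap.fderiv]
  simp [eq_comm]

theorem matPd_parallelFrame (G : R4 → Matrix (Fin 4) (Fin 4) ℝ) (x₀ : R4)
    (A₀ : Matrix (Fin 4) (Fin 4) ℝ) (p : Fin 4) :
    matPd p (parallelFrame G x₀ A₀) x₀ = -connMat G p x₀ * parallelFrame G x₀ A₀ x₀ := by
  have hU : IsOpen (Set.univ : Set R4) := isOpen_univ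
  have h1 := (smooth_parallelFrame_factor G x₀ Set.univ).matDiffAt hU (Set.mem_univ x₀)
  have h2 : matPd p (fun y => 1 - ∑ q, (y q - x₀ q) • connMat G q x₀) x₀ = -connMat G p x₀ := by
    ext i j
    have hc : ∀ q, DifferentiableAt ℝ (fun y : R4 => y q) x₀ := fun q =>
      ((smooth_coord q).differentiable (by simp)).differentiableAt
    have hq : ∀ q, DifferentiableAt ℝ (fun y : R4 => (y q - x₀ q) * connMat G q x₀ i j) x₀ :=
      fun q => ((hc q).sub_const _).mul_const _
    have hp : ∀ q, pd p (fun y : R4 => (y q - x₀ q) * connMat G q x₀ i j) x₀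
        = if p = q then connMat G q x₀ i j else 0 := by
      intro q
      rw [pd_mul p ((hc q).sub_const _) (differentiableAt_const _), pd_const,
        pd_sub p (hc q) (differentiableAt_const _), pd_const, pd_coord]
      simp
    simp only [matPd, parallelFrame_factor_apply, Matrix.of_apply]
    rw [pd_sub p (differentiableAt_const _) (DifferentiableAt.fun_sum fun q _ => hq q), pd_const,
      pd_sum _ _ fun q _ => hq q]
    simp [hp]
  rw [parallelFrame_self]
  unfold parallelFrame
  rw [matPd_mul p h1 (T := fun _ => A₀) fun _ _ => differentiableAt_const _, h2, matPd_const,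
    mul_zero, add_zero]

theorem MatDiffAt.pullTwo (hA : MatDiffAt A x) (hT : MatDiffAt T x) :
    MatDiffAt (fun y => pullTwo (A y) (T y)) x :=
  (hA.transpose.mul hT).mul hA

theorem MatDiffAt.pullFour (hA : MatDiffAt A x) (hL : ∀ i j, MatDiffAt (fun y => L y i j) x)
    (a b : Fin 4) : MatDiffAt (fun y => pullFour (A y) (L y) a b) x := fun c d =>
  hA.pullTwo (T := fun y => Matrix.of fun i j => RicciSoliton.pullTwo (A y) (L y i j) c d)
    (fun i j => hA.pullTwo (hL i j) c d) a b

theorem MatSmoothOn.pullTwo (hA : MatSmoothOn A U) (hT : MatSmoothOn T U) :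
    MatSmoothOn (fun y => pullTwo (A y) (T y)) U :=
  (hA.transpose.mul hT).mul hA

/-- The components of a tensor in the frame `A` have as derivatives the components of the
covariant derivative, if `A` is parallel to first order. -/
theorem matPd_pullTwo {p : Fin 4} (hA : MatDiffAt A x) (hT : MatDiffAt T x)
    (hp : matPd p A x = -connMat G p x * A x) :
    matPd p (fun y => pullTwo (A y) (T y)) x = pullTwo (A x) (covTwo G p T x) := by
  unfold pullTwo covTwo
  rw [matPd_mul p (hA.transpose.mul hT) hA, matPd_mul p hA.transpose hT, matPd_transpose, hp]
  simp only [Matrix.transpose_mul, Matrix.transpose_neg]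
  noncomm_ring

theorem matPd_pullFour {p : Fin 4} (hA : MatDiffAt A x)
    (hL : ∀ i j, MatDiffAt (riemMat G i j) x) (hp : matPd p A x = -connMat G p x * A x)
    (a b : Fin 4) : matPd p (fun y => pullFour (A y) (fun i j => riemMat G i j y) a b) x
      = pullFour (A x) (fun i j => covRiem G p i j x) a b := by
  ext c d
  have h1 : ∀ i j, matPd p (fun y => pullTwo (A y) (riemMat G i j y)) x
      = pullTwo (A x) (covRiemPair G p i j x) := fun i j => matPd_pullTwo hA (hL i j) hp
  have h2 := matPd_pullTwo (T := fun y => Matrix.of fun i j => pullTwo (A y) (riemMat G i j y) c d)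
    hA (fun i j => hA.pullTwo (hL i j) c d) hp
  have h3 : covTwo G p (fun y => Matrix.of fun i j => pullTwo (A y) (riemMat G i j y) c d) x
      = Matrix.of fun i j => pullTwo (A x) (covRiem G p i j x) c d := by
    ext i j
    have h4 : matPd p (fun y => Matrix.of fun i j => pullTwo (A y) (riemMat G i j y) c d) x i j
        = pullTwo (A x) (covRiemPair G p i j x) c d := congrFun (congrFun (h1 i j) c) d
    have h5 : ∀ (s : Fin 4 → ℝ) (T : Fin 4 → Matrix (Fin 4) (Fin 4) ℝ),
        pullTwo (A x) (∑ m, s m • T m) c d = ∑ m, s m * pullTwo (A x) (T m) c d := by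
      intro s T
      simp only [pullTwo_sum, pullTwo_smul, Matrix.sum_apply, Matrix.smul_apply, smul_eq_mul]
    simp only [covTwo, Matrix.sub_apply, h4, Matrix.of_apply, covRiem, pullTwo_sub, h5,
      Matrix.mul_apply, Matrix.transpose_apply, connMat]
    congr 1
    exact Finset.sum_congr rfl fun m _ => mul_comm _ _
  rw [h3] at h2
  exact congrFun (congrFun h2 a) b

/-- Differentiation of the expression of the Weyl tensor where the metric is the identity matrix to
first order. -/
theorem pd_weylOf {g P : R4 → Matrix (Fin 4) (Fin 4) ℝ} {s : R4 → ℝ} {p : Fin 4}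
    (hg : MatDiffAt g x) (hP : MatDiffAt P x) (hL : ∀ i j, MatDiffAt (fun y => L y i j) x)
    (hs : DifferentiableAt ℝ s x) (h1 : g x = 1) (h0 : matPd p g x = 0) (i j k l : Fin 4) :
    DifferentiableAt ℝ (fun y => weylOf (g y) (L y) (P y) (s y) i j k l) x ∧
    pd p (fun y => weylOf (g y) (L y) (P y) (s y) i j k l) x
      = weylOf 1 (fun i j => matPd p (fun y => L y i j) x) (matPd p P x) (pd p s x) i j k l := by
  have h0' : ∀ a b, pd p (fun y => g y a b) x = 0 := fun a b => congrFun (congrFun h0 a) b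
  have hPg : ∀ a b c d, DifferentiableAt ℝ (fun y => P y a b * g y c d) x ∧
      pd p (fun y => P y a b * g y c d) x = matPd p P x a b * (1 : Matrix (Fin 4) (Fin 4) ℝ) c d := by
    intro a b c d
    refine ⟨(hP a b).fun_mul (hg c d), ?_⟩
    rw [pd_mul p (hP a b) (hg c d), h0', h1, mul_zero, add_zero]
    rfl
  have hgg : ∀ a b c d, DifferentiableAt ℝ (fun y => g y a b * g y c d) x ∧
      pd p (fun y => g y a b * g y c d) x = 0 := by
    intro a b c d
    refine ⟨(hg a b).fun_mul (hg c d), ?_⟩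
    rw [pd_mul p (hg a b) (hg c d), h0', h0', mul_zero, zero_mul, add_zero]
  have d1 := ((hPg i k j l).1.fun_add (hPg j l i k).1)
  have d2 := d1.fun_sub (hPg i l j k).1
  have d3 := d2.fun_sub (hPg j k i l).1
  have d4 := (hgg i k j l).1.fun_sub (hgg i l j k).1
  have d5 := hL i j k l
  have d6 : DifferentiableAt ℝ (fun y => s y / 6) x := by
    simp only [div_eq_mul_inv]
    exact hs.mul_const _
  have d7 := d3.const_mul (1 / 2)
  have d8 := d6.fun_mul d4
  simp only [weylOf, Matrix.of_apply]
  refine ⟨(d5.fun_sub d7).fun_add d8, ?_⟩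
  rw [pd_add p (d5.fun_sub d7) d8, pd_sub p d5 d7, pd_const_mul p _ d3, pd_sub p d2 (hPg j k i l).1,
    pd_sub p d1 (hPg i l j k).1, pd_add p (hPg i k j l).1 (hPg j l i k).1, pd_mul p d6 d4,
    pd_sub p (hgg i k j l).1 (hgg i l j k).1]
  have hs6 : pd p (fun y => s y / 6) x = pd p s x / 6 := by
    simp only [div_eq_inv_mul]
    exact pd_const_mul p _ hs
  rw [(hPg _ _ _ _).2, (hPg _ _ _ _).2, (hPg _ _ _ _).2, (hPg _ _ _ _).2, (hgg _ _ _ _).2,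
    (hgg _ _ _ _).2, hs6, h1]
  simp only [matPd, Matrix.of_apply]
  ring

theorem pd_matDot {C S : R4 → Matrix (Fin 4) (Fin 4) ℝ} {p : Fin 4}
    (hC : MatDiffAt C x) (hS : MatDiffAt S x) :
    DifferentiableAt ℝ (fun y => matDot (C y) (S y)) x ∧
    pd p (fun y => matDot (C y) (S y)) x
      = matDot (matPd p C x) (S x) + matDot (C x) (matPd p S x) := by
  have d : ∀ a c, DifferentiableAt ℝ (fun y => C y a c * S y a c) x := fun a c =>
    (hC a c).fun_mul (hS a c)
  have d2 : ∀ a, DifferentiableAt ℝ (fun y => ∑ c, C y a c * S y a c) x := fun a =>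
    DifferentiableAt.fun_sum fun c _ => d a c
  unfold matDot
  refine ⟨DifferentiableAt.fun_sum fun a _ => d2 a, ?_⟩
  rw [pd_sum _ _ fun a _ => d2 a, ← Finset.sum_add_distrib]
  refine Finset.sum_congr rfl fun a _ => ?_
  rw [pd_sum _ _ fun c _ => d a c, ← Finset.sum_add_distrib]
  exact Finset.sum_congr rfl fun c _ => pd_mul p (hC a c) (hS a c)

theorem matDot_zero_left (S : Matrix (Fin 4) (Fin 4) ℝ) : matDot 0 S = 0 := by
  simp [matDot]

theorem matDot_one_left (S : Matrix (Fin 4) (Fin 4) ℝ) : matDot 1 S = ∑ a, S a a := by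
  simp [matDot, Matrix.one_apply]

theorem pd_epsOf {H : R4 → Matrix (Fin 4) (Fin 4) ℝ} {p : Fin 4} (hH : MatDiffAt H x)
    (hL : ∀ i j, MatDiffAt (fun y => L y i j) x) (h1 : H x = 1) (h0 : matPd p H x = 0)
    (i j k l : Fin 4) :
    DifferentiableAt ℝ (fun y => epsOf (H y) (L y) i j k l) x ∧
    pd p (fun y => epsOf (H y) (L y) i j k l) x
      = epsOf 1 (fun i j => matPd p (fun y => L y i j) x) i j k l := by
  have hY : MatDiffAt (fun y => Matrix.of fun m n => L y m n k l) x := fun m n => hL m n k l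
  have h2 := pd_matDot (p := p) (C := fun _ => leviCivitaMat i j)
    (fun _ _ => differentiableAt_const _) ((hH.mul hY).mul hH.transpose)
  refine ⟨h2.1, h2.2.trans ?_⟩
  rw [matPd_const, matDot_zero_left, zero_add, matPd_mul p (hH.mul hY) hH.transpose,
    matPd_mul p hH hY, matPd_transpose, h0, h1]
  simp only [epsOf, Matrix.of_apply, Matrix.transpose_zero, Matrix.transpose_one, zero_mul,
    mul_zero, one_mul, mul_one, zero_add, add_zero]
  rfl

end ParallelFrame

/-! ### Gradient Ricci solitons on open subsets of `ℝ⁴` -/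

section LocalSolitons

open scoped MatrixOrder Matrix.Norms.L2Operator in
theorem exists_orthonormal_frame {g : Matrix (Fin 4) (Fin 4) ℝ} (hg : g.PosDef) :
    ∃ B, pullTwo B g = 1 := by
  obtain ⟨C, hC⟩ := CStarAlgebra.nonneg_iff_eq_star_mul_self.mp hg.posSemidef.nonneg
  have hdet : IsUnit C.det := by
    have h1 := hg.det_pos
    rw [hC, Matrix.det_mul] at h1
    exact (right_ne_zero_of_mul h1.ne').isUnit
  refine ⟨C⁻¹, ?_⟩
  have h2 : star C = C.transpose := by
    ext i j
    simp [Matrix.star_apply]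
  have hdet' : IsUnit C.transpose.det := by rwa [Matrix.det_transpose]
  rw [hC, pullTwo, h2, Matrix.transpose_nonsing_inv, ← mul_assoc,
    Matrix.nonsing_inv_mul _ hdet', one_mul, Matrix.mul_nonsing_inv _ hdet]

/-- An orthonormal frame whose last three vectors are annihilated by a given covector. -/
theorem exists_adapted_frame {g : Matrix (Fin 4) (Fin 4) ℝ} (hg : g.PosDef) {f : Fin 4 → ℝ}
    (hf : f ≠ 0) : ∃ (A : Matrix (Fin 4) (Fin 4) ℝ) (φ : ℝ), φ ≠ 0 ∧ pullTwo A g = 1 ∧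
      ∀ a, ∑ i, A i a * f i = φ * (1 : Matrix (Fin 4) (Fin 4) ℝ) 0 a := by
  obtain ⟨B, hB⟩ := exists_orthonormal_frame hg
  have hdet : IsUnit B.transpose.det := by
    have h1 := congrArg Matrix.det hB
    rw [pullTwo, Matrix.det_mul, Matrix.det_mul, Matrix.det_one] at h1
    rw [isUnit_iff_ne_zero]
    intro h0
    simp [h0] at h1
  set w : R4 := WithLp.toLp 2 (B.transpose.mulVec f) with hw
  have hw0 : w ≠ 0 := by
    intro h0
    apply hf
    have h1 : B.transpose.mulVec f = 0 := by
      have := congrArg WithLp.ofLp h0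
      simpa [hw] using this
    have h2 := congrArg (fun v => (B.transpose)⁻¹.mulVec v) h1
    simpa [Matrix.mulVec_mulVec, Matrix.nonsing_inv_mul _ hdet] using h2
  have hn : ‖w‖ ≠ 0 := norm_ne_zero_iff.2 hw0
  obtain ⟨b, hb⟩ : ∃ b : OrthonormalBasis (Fin 4) ℝ R4, b 0 = (‖w‖⁻¹ : ℝ) • w := by
    have hv : Orthonormal ℝ (({0} : Set (Fin 4)).domRestrict fun _ => (‖w‖⁻¹ : ℝ) • w) := by
      rw [orthonormal_iff_ite]
      intro i j
      have hij : i = j := Subsingleton.elim _ _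
      simp only [Set.domRestrict_apply, hij, if_true]
      rw [real_inner_self_eq_norm_sq, norm_smul, norm_inv, norm_norm, inv_mul_cancel₀ hn, one_pow]
    obtain ⟨b, hb⟩ := hv.exists_orthonormalBasis_extension_of_card_eq (by simp)
    exact ⟨b, hb 0 rfl⟩
  set O : Matrix (Fin 4) (Fin 4) ℝ := Matrix.of fun i a => b a i with hO
  have hinner : ∀ (u v : R4), inner ℝ u v = ∑ i, u i * v i := by
    intro u v
    simp [PiLp.inner_apply, mul_comm]
  have hOO : O.transpose * O = 1 := by
    ext a c
    simp only [Matrix.mul_apply, Matrix.transpose_apply, hO, Matrix.of_apply, ← hinner,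
      orthonormal_iff_ite.1 b.orthonormal, Matrix.one_apply]
  refine ⟨B * O, ‖w‖, hn, ?_, fun a => ?_⟩
  · rw [← hOO]
    have : pullTwo (B * O) g = O.transpose * pullTwo B g * O := by
      simp only [pullTwo, Matrix.transpose_mul, mul_assoc]
    rw [this, hB, mul_one]
  · have h1 : ∑ i, (B * O) i a * f i = inner ℝ (b a) w := by
      have h2 : ∑ i, (B * O) i a * f i = ((B * O).transpose.mulVec f) a := rfl
      rw [h2, Matrix.transpose_mul, ← Matrix.mulVec_mulVec, hinner]
      rfl
    have h3 : w = ‖w‖ • b 0 := by rw [hb, smul_smul, mul_inv_cancel₀ hn, one_smul]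
    rw [h1]
    conv_lhs => rw [h3]
    rw [inner_smul_right, orthonormal_iff_ite.1 b.orthonormal, Matrix.one_apply]
    simp only [eq_comm]

/-- A gradient Ricci soliton with `W + s ⋆ W = 0` on an open subset `U` of `ℝ⁴`; the function `s`
is the sign of the coordinate frame. -/
structure IsDualSolitonOn (G : R4 → Matrix (Fin 4) (Fin 4) ℝ) (F : R4 → ℝ) (s : R4 → ℝ) (ρ : ℝ)
    (U : Set R4) : Prop where
  metric : IsMetricOn G U
  smooth : ContDiffOn ℝ ∞ F U
  equation : ∀ x ∈ U, ∀ i j, ricci G x i j + hessian G F x i j = ρ * G x i j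
  weylPlus_eq_zero : ∀ x ∈ U, ∀ i j k l, weylPlus (s x) G x i j k l = 0
  locallyConstant : ∀ x ∈ U, ∀ᶠ y in nhds x, s y = s x

variable {G : R4 → Matrix (Fin 4) (Fin 4) ℝ} {x : R4} {U : Set R4}

/-- The Ricci tensor as a matrix-valued function. -/
def ricMat (G : R4 → Matrix (Fin 4) (Fin 4) ℝ) (x : R4) : Matrix (Fin 4) (Fin 4) ℝ :=
  Matrix.of (ricci G x)

namespace IsMetricOn

theorem smooth_ricMat (h : IsMetricOn G U) : MatSmoothOn (ricMat G) U := by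
  intro j l
  have h1 : (fun y => ricMat G y j l) = fun y => ∑ i, ∑ k, (G y)⁻¹ i k * riemMat G i j y k l := rfl
  rw [h1]
  exact ContDiffOn.sum fun i _ => ContDiffOn.sum fun k _ =>
    (h.smooth_inv i k).mul (h.smooth_riemMat i j k l)

theorem smooth_scalarCurvature (h : IsMetricOn G U) : ContDiffOn ℝ ∞ (scalarCurvature G) U :=
  ContDiffOn.sum fun j _ => ContDiffOn.sum fun l _ => (h.smooth_inv j l).mul (h.smooth_ricMat j l)

end IsMetricOn

namespace IsDualSolitonOn

variable {F s : R4 → ℝ} {ρ : ℝ}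

theorem ricMat_eq (h : IsDualSolitonOn G F s ρ U) (hx : x ∈ U) :
    ricMat G x = ρ • G x - hessMat G F x := by
  ext i j
  have := h.equation x hx i j
  simp only [ricMat, hessMat, Matrix.of_apply, Matrix.sub_apply, Matrix.smul_apply, smul_eq_mul]
  linarith

theorem ricMat_transpose (h : IsDualSolitonOn G F s ρ U) (hx : x ∈ U) :
    (ricMat G x).transpose = ricMat G x := by
  rw [h.ricMat_eq hx, Matrix.transpose_sub, Matrix.transpose_smul, h.metric.transpose_eq hx]
  congr 1
  ext i j
  exact h.metric.hessian_symm h.smooth hx j i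

theorem covTwo_ricMat (h : IsDualSolitonOn G F s ρ U) (hx : x ∈ U) (p : Fin 4) :
    covTwo G p (ricMat G) x = -covTwo G p (hessMat G F) x := by
  have h1 : ricMat G =ᶠ[nhds x] fun y => (ρ • (1 : Matrix (Fin 4) (Fin 4) ℝ)) * G y
      - hessMat G F y := by
    filter_upwards [h.metric.isOpen.mem_nhds hx] with y hy
    rw [h.ricMat_eq hy, smul_mul_assoc, one_mul]
  have hG := h.metric.smooth.matDiffAt h.metric.isOpen hx
  have hH := (h.metric.smooth_hessMat h.smooth).matDiffAt h.metric.isOpen hx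
  have hc : MatDiffAt (fun _ => ρ • (1 : Matrix (Fin 4) (Fin 4) ℝ)) x :=
    fun _ _ => differentiableAt_const _
  unfold covTwo
  rw [matPd_congr h1, matPd_sub p (hc.mul hG) hH, matPd_mul p hc hG, matPd_const,
    h.metric.matPd_eq hx, h.ricMat_eq hx]
  simp only [smul_mul_assoc, mul_smul_comm, one_mul, zero_mul, zero_add, mul_sub, sub_mul,
    mul_add]
  abel

/-- The Cotton tensor of a gradient Ricci soliton. -/
theorem covTwo_ricMat_sub (h : IsDualSolitonOn G F s ρ U) (hx : x ∈ U) (p i j : Fin 4) :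
    covTwo G p (ricMat G) x i j - covTwo G i (ricMat G) x p j
      = ∑ n, curvatureUp G x n p i j * pd n F x := by
  have := h.metric.covTwo_hessMat_sub h.smooth hx p i j
  rw [h.covTwo_ricMat hx, h.covTwo_ricMat hx, Matrix.neg_apply, Matrix.neg_apply]
  linarith

end IsDualSolitonOn

end LocalSolitons

/-! ### Tensor symmetries in a frame -/

section AdaptedFrames

section Symmetries

variable {A : Matrix (Fin 4) (Fin 4) ℝ} {L : Fin 4 → Fin 4 → Matrix (Fin 4) (Fin 4) ℝ}

theorem pullFour_apply_sum (A : Matrix (Fin 4) (Fin 4) ℝ)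
    (L : Fin 4 → Fin 4 → Matrix (Fin 4) (Fin 4) ℝ) (a b c d : Fin 4) :
    pullFour A L a b c d
      = ∑ i, ∑ j, ∑ k, ∑ l, A i a * A j b * (A k c * A l d * L i j k l) := by
  simp only [pullFour, pullTwo_apply, Matrix.of_apply, Finset.mul_sum]

theorem pullFour_swap (hL : ∀ i j, L i j = -L j i) (a b : Fin 4) :
    pullFour A L a b = -pullFour A L b a := by
  ext c d
  have h1 : (Matrix.of fun i j => pullTwo A (L i j) c d)
      = -(Matrix.of fun i j => pullTwo A (L i j) c d).transpose := by
    ext i j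
    simp only [Matrix.of_apply, Matrix.neg_apply, Matrix.transpose_apply]
    rw [hL i j, pullTwo_neg, Matrix.neg_apply]
  simp only [pullFour, Matrix.of_apply, Matrix.neg_apply]
  conv_lhs => rw [h1, pullTwo_neg, pullTwo_transpose]
  rfl

theorem pullFour_swap' (hL : ∀ i j, (L i j).transpose = -L i j) (a b c d : Fin 4) :
    pullFour A L a b c d = -pullFour A L a b d c := by
  have h1 : pullFour A L a b = -(pullFour A L a b).transpose := by
    rw [← pullFour_transpose]
    have : (fun i j => (L i j).transpose) = fun i j => (-1 : ℝ) • L i j := by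
      funext i j
      rw [hL, neg_one_smul]
    rw [this, pullFour_smul, neg_one_smul, neg_neg]
  exact congrFun (congrFun h1 c) d

theorem sum_rotate (T : Fin 4 → Fin 4 → Fin 4 → ℝ) :
    ∑ i, ∑ j, ∑ k, T i j k = ∑ i, ∑ j, ∑ k, T j k i := by
  simp only [← Fintype.sum_prod_type']
  exact Fintype.sum_equiv ⟨fun z => (z.2.2, z.1, z.2.1), fun z => (z.2.1, z.2.2, z.1),
    fun _ => rfl, fun _ => rfl⟩ _ _ fun z => rfl

theorem sum_cyclic_eq_zero {X : Fin 4 → Fin 4 → Fin 4 → ℝ}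
    (hX : ∀ i j k, X i j k + X j k i + X k i j = 0) (u v w : Fin 4 → ℝ) :
    ∑ i, ∑ j, ∑ k, u i * v j * w k * X i j k + ∑ i, ∑ j, ∑ k, v i * w j * u k * X i j k
      + ∑ i, ∑ j, ∑ k, w i * u j * v k * X i j k = 0 := by
  rw [sum_rotate fun i j k => v i * w j * u k * X i j k, ← sum_rotate fun i j k =>
    w k * u i * v j * X k i j]
  simp only [← Finset.sum_add_distrib]
  refine Finset.sum_eq_zero fun i _ => Finset.sum_eq_zero fun j _ =>
    Finset.sum_eq_zero fun k _ => ?_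
  linear_combination u i * v j * w k * hX i j k

theorem pullFour_bianchi (hL : ∀ i j k l, L i j k l + L j l k i + L l i k j = 0)
    (a b c d : Fin 4) :
    pullFour A L a b c d + pullFour A L b d c a + pullFour A L d a c b = 0 := by
  have h1 : ∀ a b d, pullFour A L a b c d
      = ∑ i, ∑ j, ∑ l, A i a * A j b * A l d * ∑ k, A k c * L i j k l := by
    intro a b d
    rw [pullFour_apply_sum]
    refine Finset.sum_congr rfl fun i _ => Finset.sum_congr rfl fun j _ => ?_
    rw [Finset.sum_comm]
    refine Finset.sum_congr rfl fun l _ => ?_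
    rw [Finset.mul_sum]
    exact Finset.sum_congr rfl fun k _ => by ring
  rw [h1, h1, h1]
  refine sum_cyclic_eq_zero (fun i j l => ?_) (fun i => A i a) (fun i => A i b) fun i => A i d
  rw [← Finset.sum_add_distrib, ← Finset.sum_add_distrib]
  refine Finset.sum_eq_zero fun k _ => ?_
  linear_combination A k c * hL i j k l

theorem mul_pullTwo_inv_mul {g : Matrix (Fin 4) (Fin 4) ℝ} (hA : IsUnit A.det) :
    A * (pullTwo A g)⁻¹ * A.transpose = g⁻¹ := by
  have hA' : IsUnit A.transpose.det := by rwa [Matrix.det_transpose]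
  rw [pullTwo, Matrix.mul_inv_rev, Matrix.mul_inv_rev, ← mul_assoc, ← mul_assoc,
    Matrix.mul_nonsing_inv _ hA, one_mul, mul_assoc, Matrix.nonsing_inv_mul _ hA', mul_one]

end Symmetries

variable {G : R4 → Matrix (Fin 4) (Fin 4) ℝ} {x : R4} {U : Set R4}

theorem covRiem_swap (G : R4 → Matrix (Fin 4) (Fin 4) ℝ) (x : R4) (p i j : Fin 4) :
    covRiem G p i j x = -covRiem G p j i x := by
  have h1 : covRiemPair G p i j x = -covRiemPair G p j i x := by
    have h2 : riemMat G i j = fun y => -riemMat G j i y := funext fun y => riemMat_swap G i j y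
    unfold covRiemPair
    rw [h2, matPd_neg]
    noncomm_ring
  have h3 : ∀ a b, ∑ m, christoffel G x m p a • riemMat G m b x
      = -∑ m, christoffel G x m p a • riemMat G b m x := by
    intro a b
    rw [← Finset.sum_neg_distrib]
    exact Finset.sum_congr rfl fun m _ => by rw [riemMat_swap, smul_neg]
  unfold covRiem
  rw [h1, h3 i j, h3 j i]
  abel

namespace IsMetricOn

theorem covRiem_transpose (h : IsMetricOn G U) (hx : x ∈ U) (p i j : Fin 4) :
    (covRiem G p i j x).transpose = -covRiem G p i j x := by
  have h0 := fun a b => h.riemMat_transpose hx a b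
  have h1 : (covRiemPair G p i j x).transpose = -covRiemPair G p i j x := by
    have h2 : (matPd p (riemMat G i j) x).transpose = -matPd p (riemMat G i j) x := by
      rw [← matPd_neg, ← matPd_transpose]
      refine matPd_congr ?_
      filter_upwards [h.isOpen.mem_nhds hx] with y hy
      exact h.riemMat_transpose hy i j
    unfold covRiemPair
    simp only [Matrix.transpose_sub, Matrix.transpose_mul, Matrix.transpose_transpose, h2, h0]
    noncomm_ring
  unfold covRiem
  simp only [Matrix.transpose_sub, Matrix.transpose_sum, Matrix.transpose_smul, h1, h0, smul_neg,
    Finset.sum_neg_distrib]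
  abel

end IsMetricOn

/-! ### The curvature in a frame adapted to the gradient -/

/-- The covariant derivative of the Riemann tensor in the frame `A`. -/
def frameCovRiem (G : R4 → Matrix (Fin 4) (Fin 4) ℝ) (x : R4) (A : Matrix (Fin 4) (Fin 4) ℝ)
    (e a b : Fin 4) : Matrix (Fin 4) (Fin 4) ℝ :=
  ∑ p, A p e • pullFour A (fun i j => covRiem G p i j x) a b

/-- The covariant derivative of the Ricci tensor in the frame `A`. -/
def frameCovRic (G : R4 → Matrix (Fin 4) (Fin 4) ℝ) (x : R4) (A : Matrix (Fin 4) (Fin 4) ℝ)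
    (e : Fin 4) : Matrix (Fin 4) (Fin 4) ℝ :=
  ∑ p, A p e • pullTwo A (covTwo G p (ricMat G) x)

/-- The derivative of the scalar curvature in the frame `A`. -/
def frameDScalar (G : R4 → Matrix (Fin 4) (Fin 4) ℝ) (x : R4) (A : Matrix (Fin 4) (Fin 4) ℝ)
    (e : Fin 4) : ℝ :=
  ∑ p, A p e * pd p (scalarCurvature G) x

variable {A₀ : Matrix (Fin 4) (Fin 4) ℝ}

theorem isUnit_det_of_pullTwo {A g : Matrix (Fin 4) (Fin 4) ℝ} (hA : pullTwo A g = 1) :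
    IsUnit A.det := by
  have h1 := congrArg Matrix.det hA
  rw [pullTwo, Matrix.det_mul, Matrix.det_mul, Matrix.det_one] at h1
  exact (right_ne_zero_of_mul_eq_one h1).isUnit

theorem eventually_isUnit_det (hA : IsUnit A₀.det) :
    ∀ᶠ y in nhds x, IsUnit (parallelFrame G x A₀ y).det := by
  have h1 : ContinuousAt (fun y => (parallelFrame G x A₀ y).det) x :=
    ((smooth_parallelFrame G x A₀ Set.univ).det.continuousOn).continuousAt Filter.univ_mem
  have h2 : (parallelFrame G x A₀ x).det ≠ 0 := by
    rw [parallelFrame_self]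
    exact hA.ne_zero
  filter_upwards [h1.eventually_ne h2] with y hy
  exact hy.isUnit

theorem ricMat_eq_sum (hA : pullTwo A₀ (G x) = 1) (b d : Fin 4) : pullTwo A₀ (ricMat G x) b d
    = ∑ a, pullFour A₀ (fun i j => riemMat G i j x) a b a d := by
  have h1 := contractOf_pullFour (mul_pullTwo_inv_mul (g := G x) (isUnit_det_of_pullTwo hA))
    fun i j => riemMat G i j x
  rw [hA, inv_one] at h1
  have h2 := congrFun (congrFun h1.symm b) d
  refine h2.trans ?_
  exact matDot_one_left (Matrix.of fun a c => pullFour A₀ (fun i j => riemMat G i j x) a b c d)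

theorem scalarCurvature_eq_sum (hA : pullTwo A₀ (G x) = 1) :
    scalarCurvature G x = ∑ b, pullTwo A₀ (ricMat G x) b b := by
  have h1 : scalarCurvature G x = matDot (G x)⁻¹ (ricMat G x) := rfl
  rw [h1, ← mul_pullTwo_inv_mul (g := G x) (isUnit_det_of_pullTwo hA), ← matDot_pullTwo, hA,
    inv_one, matDot_one_left]

namespace IsMetricOn

variable (h : IsMetricOn G U) (hx : x ∈ U) (hA : pullTwo A₀ (G x) = 1)
include h hx

theorem matDiffAt_parallelFrame : MatDiffAt (parallelFrame G x A₀) x :=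
  (smooth_parallelFrame G x A₀ U).matDiffAt h.isOpen hx

theorem matPd_pullTwo_metric (p : Fin 4) :
    matPd p (fun y => pullTwo (parallelFrame G x A₀ y) (G y)) x = 0 := by
  rw [matPd_pullTwo (h.matDiffAt_parallelFrame hx) (h.smooth.matDiffAt h.isOpen hx)
    (matPd_parallelFrame G x A₀ p)]
  unfold covTwo
  rw [h.matPd_eq hx]
  simp [pullTwo]

include hA

/-- The inverse metric in the frame is the identity matrix to first order. -/
theorem inv_pullTwo_metric (p : Fin 4) :
    MatDiffAt (fun y => (pullTwo (parallelFrame G x A₀ y) (G y))⁻¹) x ∧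
    (pullTwo (parallelFrame G x A₀ x) (G x))⁻¹ = 1 ∧
    matPd p (fun y => (pullTwo (parallelFrame G x A₀ y) (G y))⁻¹) x = 0 := by
  have hs : MatSmoothOn (fun y => pullTwo (parallelFrame G x A₀ y) (G y)) U :=
    (smooth_parallelFrame G x A₀ U).pullTwo h.smooth
  have hc : ContinuousOn (fun y => (pullTwo (parallelFrame G x A₀ y) (G y)).det) U :=
    hs.det.continuousOn
  set V := U ∩ (fun y => (pullTwo (parallelFrame G x A₀ y) (G y)).det) ⁻¹' {0}ᶜ with hV
  have hVo : IsOpen V := hc.isOpen_inter_preimage h.isOpen isOpen_compl_singleton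
  have h1 : pullTwo (parallelFrame G x A₀ x) (G x) = 1 := by rw [parallelFrame_self, hA]
  have hxV : x ∈ V := ⟨hx, by simp [h1]⟩
  have hsV : MatSmoothOn (fun y => pullTwo (parallelFrame G x A₀ y) (G y)) V :=
    fun i j => (hs i j).mono Set.inter_subset_left
  have hd : ∀ y ∈ V, (pullTwo (parallelFrame G x A₀ y) (G y)).det ≠ 0 := fun y hy => hy.2
  exact ⟨(hsV.inv hd).matDiffAt hVo hxV, by rw [h1, inv_one],
    matPd_inv_eq_zero hVo hsV hd hxV p (h.matPd_pullTwo_metric hx p)⟩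

theorem covTwo_ricMat_eq (p b d : Fin 4) :
    pullTwo A₀ (covTwo G p (ricMat G) x) b d
      = ∑ a, pullFour A₀ (fun i j => covRiem G p i j x) a b a d := by
  have hAd := h.matDiffAt_parallelFrame (A₀ := A₀) hx
  have hAp := matPd_parallelFrame G x A₀ p
  have hR : ∀ i j, MatDiffAt (riemMat G i j) x := fun i j =>
    (h.smooth_riemMat i j).matDiffAt h.isOpen hx
  obtain ⟨hHd, hH1, hH0⟩ := h.inv_pullTwo_metric hx hA p
  have h1 := matPd_pullTwo hAd (h.smooth_ricMat.matDiffAt h.isOpen hx) hAp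
  have h2 : (fun y => pullTwo (parallelFrame G x A₀ y) (ricMat G y)) =ᶠ[nhds x] fun y =>
      contractOf (pullTwo (parallelFrame G x A₀ y) (G y))⁻¹
        (pullFour (parallelFrame G x A₀ y) fun i j => riemMat G i j y) := by
    filter_upwards [eventually_isUnit_det (G := G) (x := x) (isUnit_det_of_pullTwo hA)] with y hy
    rw [contractOf_pullFour (mul_pullTwo_inv_mul hy)]
    rfl
  rw [matPd_congr h2, parallelFrame_self] at h1
  rw [← h1]
  have h3 := (pd_matDot (p := p) hHd (S := fun y => Matrix.of fun a c =>
    pullFour (parallelFrame G x A₀ y) (fun i j => riemMat G i j y) a b c d)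
    fun a c => hAd.pullFour hR a b c d).2
  refine h3.trans ?_
  rw [hH0, hH1, matDot_zero_left, zero_add, matDot_one_left]
  refine Finset.sum_congr rfl fun a _ => ?_
  have h4 := matPd_pullFour hAd hR hAp a b
  rw [parallelFrame_self] at h4
  exact congrFun (congrFun h4 a) d

theorem pd_scalarCurvature_eq (p : Fin 4) :
    pd p (scalarCurvature G) x = ∑ b, pullTwo A₀ (covTwo G p (ricMat G) x) b b := by
  have hAd := h.matDiffAt_parallelFrame (A₀ := A₀) hx
  have hAp := matPd_parallelFrame G x A₀ p
  have hP := h.smooth_ricMat.matDiffAt h.isOpen hx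
  obtain ⟨hHd, hH1, hH0⟩ := h.inv_pullTwo_metric hx hA p
  have h2 : scalarCurvature G =ᶠ[nhds x] fun y =>
      matDot (pullTwo (parallelFrame G x A₀ y) (G y))⁻¹
        (pullTwo (parallelFrame G x A₀ y) (ricMat G y)) := by
    filter_upwards [eventually_isUnit_det (G := G) (x := x) (isUnit_det_of_pullTwo hA)] with y hy
    rw [matDot_pullTwo, mul_pullTwo_inv_mul hy]
    rfl
  rw [pd_congr h2, (pd_matDot (p := p) hHd (hAd.pullTwo hP)).2, hH0, hH1, matDot_zero_left,
    zero_add, matDot_one_left, matPd_pullTwo hAd hP hAp, parallelFrame_self]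

end IsMetricOn

end AdaptedFrames

/-! ### The soliton equation and the duality relation in an adapted frame -/

section FrameCurvature

namespace IsDualSolitonOn

variable {G : R4 → Matrix (Fin 4) (Fin 4) ℝ} {x : R4} {U : Set R4} {F s : R4 → ℝ} {ρ : ℝ}
  {A₀ : Matrix (Fin 4) (Fin 4) ℝ} {φ : ℝ}

/-- In a frame adapted to the gradient, the Cotton tensor is `φ` times the contraction of the
Riemann tensor with the first frame vector. -/
theorem frameCovRic_sub (h : IsDualSolitonOn G F s ρ U) (hx : x ∈ U)
    (hA : pullTwo A₀ (G x) = 1)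
    (hF : ∀ a, ∑ i, A₀ i a * pd i F x = φ * (1 : Matrix (Fin 4) (Fin 4) ℝ) 0 a) (a b d : Fin 4) :
    frameCovRic G x A₀ a b d - frameCovRic G x A₀ b a d
      = φ * pullFour A₀ (fun i j => riemMat G i j x) a b 0 d := by
  -- The differential of `F` is `φ` times the covector dual to the first frame vector.
  have hdF : ∀ n, pd n F x = φ * ∑ k, A₀ k 0 * G x k n := by
    have h1 : A₀ * (A₀.transpose * G x) = 1 := by
      rw [pullTwo, mul_eq_one_comm] at hA
      exact hA
    have h2 : (A₀ * (A₀.transpose * G x)).transpose.mulVec (fun i => pd i F x)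
        = fun i => pd i F x := by
      rw [h1, Matrix.transpose_one, Matrix.one_mulVec]
    have h3 : A₀.transpose.mulVec (fun i => pd i F x)
        = fun a => φ * (1 : Matrix (Fin 4) (Fin 4) ℝ) 0 a := funext hF
    rw [Matrix.transpose_mul, ← Matrix.mulVec_mulVec, h3] at h2
    intro n
    rw [← congrFun h2 n]
    simp [Matrix.mulVec, dotProduct, Matrix.mul_apply, Matrix.one_apply, mul_comm]
  have hc : ∀ p i j, covTwo G p (ricMat G) x i j - covTwo G i (ricMat G) x p j
      = φ * ∑ k, A₀ k 0 * riemMat G p i x k j := by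
    intro p i j
    rw [h.covTwo_ricMat_sub hx]
    simp only [hdF, riemMat, riemann, Matrix.of_apply, Finset.mul_sum]
    rw [Finset.sum_comm]
    exact Finset.sum_congr rfl fun k _ => Finset.sum_congr rfl fun n _ => by ring
  have h1 : ∀ a b, frameCovRic G x A₀ a b d
      = ∑ p, ∑ i, ∑ j, A₀ p a * A₀ i b * A₀ j d * covTwo G p (ricMat G) x i j := by
    intro a b
    simp only [frameCovRic, Matrix.sum_apply, Matrix.smul_apply, smul_eq_mul, pullTwo_apply,
      Finset.mul_sum]
    exact Finset.sum_congr rfl fun p _ => Finset.sum_congr rfl fun i _ =>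
      Finset.sum_congr rfl fun j _ => by ring
  rw [h1 a b, h1 b a, Finset.sum_comm (f := fun p i => ∑ j, A₀ p b * A₀ i a * A₀ j d *
    covTwo G p (ricMat G) x i j), pullFour_apply_sum]
  simp only [← Finset.sum_sub_distrib, Finset.mul_sum]
  refine Finset.sum_congr rfl fun p _ => Finset.sum_congr rfl fun i _ => ?_
  conv_rhs => rw [Finset.sum_comm]
  refine Finset.sum_congr rfl fun j _ => ?_
  have h2 := hc p i j
  rw [Finset.mul_sum] at h2
  have h3 : ∑ k, φ * (A₀ p a * A₀ i b * (A₀ k 0 * A₀ j d * riemMat G p i x k j))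
      = A₀ p a * A₀ i b * A₀ j d * ∑ k, φ * (A₀ k 0 * riemMat G p i x k j) := by
    rw [Finset.mul_sum]
    exact Finset.sum_congr rfl fun k _ => by ring
  rw [h3, ← h2]
  ring

theorem solitonFrame (h : IsDualSolitonOn G F s ρ U) (hx : x ∈ U)
    (hA : pullTwo A₀ (G x) = 1) (hφ : φ ≠ 0)
    (hF : ∀ a, ∑ i, A₀ i a * pd i F x = φ * (1 : Matrix (Fin 4) (Fin 4) ℝ) 0 a) :
    SolitonFrame φ (pullFour A₀ fun i j => riemMat G i j x) (frameCovRiem G x A₀)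
      (pullTwo A₀ (ricMat G x)) (frameCovRic G x A₀) (scalarCurvature G x)
      (frameDScalar G x A₀) where
  ne_zero := hφ
  antisymm a b c d := congrFun (congrFun (pullFour_swap (fun i j => riemMat_swap G i j x) a b) c) d
  antisymm' := pullFour_swap' fun i j => h.metric.riemMat_transpose hx i j
  bianchi := pullFour_bianchi fun i j k l => h.metric.riemann_cyclic hx i j k l
  ricci := ricMat_eq_sum hA
  scalar := scalarCurvature_eq_sum hA
  d_antisymm e a b c d := by
    simp only [frameCovRiem, Matrix.sum_apply, Matrix.smul_apply, ← Finset.sum_neg_distrib]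
    refine Finset.sum_congr rfl fun p _ => ?_
    rw [pullFour_swap (fun i j => covRiem_swap G x p i j) a b, Matrix.neg_apply, smul_neg]
  d_antisymm' e a b c d := by
    simp only [frameCovRiem, Matrix.sum_apply, Matrix.smul_apply, ← Finset.sum_neg_distrib]
    refine Finset.sum_congr rfl fun p _ => ?_
    rw [pullFour_swap' (fun i j => h.metric.covRiem_transpose hx p i j) a b c d, smul_neg]
  d_bianchi e a b c d := by
    have h1 : ∀ e a b, frameCovRiem G x A₀ e a b c d = ∑ p, ∑ i, ∑ j,
        A₀ p e * A₀ i a * A₀ j b * pullTwo A₀ (covRiem G p i j x) c d := by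
      intro e a b
      simp only [frameCovRiem, Matrix.sum_apply, Matrix.smul_apply, smul_eq_mul, pullFour,
        Matrix.of_apply]
      refine Finset.sum_congr rfl fun p _ => ?_
      rw [pullTwo_apply A₀ (Matrix.of fun i j => pullTwo A₀ (covRiem G p i j x) c d),
        Finset.mul_sum]
      refine Finset.sum_congr rfl fun i _ => ?_
      rw [Finset.mul_sum]
      refine Finset.sum_congr rfl fun j _ => ?_
      rw [Matrix.of_apply]
      ring
    rw [h1, h1, h1]
    refine sum_cyclic_eq_zero (fun p i j => ?_) (fun i => A₀ i e) (fun i => A₀ i a)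
      fun i => A₀ i b
    rw [← Matrix.add_apply, ← Matrix.add_apply, ← pullTwo_add, ← pullTwo_add,
      h.metric.covRiem_cyclic hx]
    simp [pullTwo]
  d_ricci e b d := by
    simp only [frameCovRic, frameCovRiem, Matrix.sum_apply, Matrix.smul_apply, smul_eq_mul]
    rw [Finset.sum_comm]
    refine Finset.sum_congr rfl fun p _ => ?_
    rw [h.metric.covTwo_ricMat_eq hx hA, Finset.mul_sum]
  d_ricci_symm e b d := by
    have h1 : ∀ p, (covTwo G p (ricMat G) x).transpose = covTwo G p (ricMat G) x := by
      intro p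
      have h2 : (matPd p (ricMat G) x).transpose = matPd p (ricMat G) x := by
        rw [← matPd_transpose]
        refine matPd_congr ?_
        filter_upwards [h.metric.isOpen.mem_nhds hx] with y hy
        exact h.ricMat_transpose hy
      unfold covTwo
      simp only [Matrix.transpose_sub, Matrix.transpose_mul, Matrix.transpose_transpose, h2,
        h.ricMat_transpose hx]
      abel
    simp only [frameCovRic, Matrix.sum_apply, Matrix.smul_apply]
    refine Finset.sum_congr rfl fun p _ => ?_
    conv_lhs => rw [← h1 p, pullTwo_transpose]
    rfl
  d_scalar e := by
    simp only [frameDScalar, frameCovRic, Matrix.sum_apply, Matrix.smul_apply, smul_eq_mul]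
    rw [Finset.sum_comm]
    refine Finset.sum_congr rfl fun p _ => ?_
    rw [h.metric.pd_scalarCurvature_eq hx hA, Finset.mul_sum]
  soliton := h.frameCovRic_sub hx hA hF

/-- The equation `W + s ⋆ W = 0` in a frame `A`. -/
theorem weylOf_add_epsOf (h : IsDualSolitonOn G F s ρ U) (hx : x ∈ U)
    {A : Matrix (Fin 4) (Fin 4) ℝ} (hA : IsUnit A.det) {W : Fin 4 → Fin 4 → Matrix (Fin 4) (Fin 4) ℝ}
    (hW : W = weylOf (pullTwo A (G x)) (pullFour A fun i j => riemMat G i j x)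
      (pullTwo A (ricMat G x)) (scalarCurvature G x)) (a b c d : Fin 4) :
    W a b c d + 1 / 2 * (s x * (Real.sqrt (G x).det * A.det))
      * epsOf (pullTwo A (G x))⁻¹ W a b c d = 0 := by
  have hW' : W = pullFour A fun i j => Matrix.of (weyl G x i j) := by
    rw [hW, ← pullFour_weylOf]
    rfl
  have h1 : ∀ i j, Matrix.of (weyl G x i j) = (-(1 / 2 * (s x * Real.sqrt (G x).det))) •
      epsOf (G x)⁻¹ (fun i j => Matrix.of (weyl G x i j)) i j := by
    intro i j
    ext k l
    have h2 := h.weylPlus_eq_zero x hx i j k l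
    rw [weylPlus_eq] at h2
    simp only [Matrix.of_apply, Matrix.smul_apply, smul_eq_mul]
    linarith
  have h3 : W a b = (-(1 / 2 * (s x * Real.sqrt (G x).det))) •
      (A.det • epsOf (pullTwo A (G x))⁻¹ W a b) := by
    conv_lhs => rw [hW', funext fun i => funext (h1 i), pullFour_smul,
      pullFour_epsOf (mul_pullTwo_inv_mul hA), ← hW']
  rw [h3]
  simp only [Matrix.smul_apply, smul_eq_mul]
  ring

theorem weylOf_swap {g P : Matrix (Fin 4) (Fin 4) ℝ} {r : ℝ}
    {L : Fin 4 → Fin 4 → Matrix (Fin 4) (Fin 4) ℝ} (hL : ∀ a b c d, L a b c d = -L b a c d)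
    (a b c d : Fin 4) : weylOf g L P r a b c d = -weylOf g L P r b a c d := by
  simp only [weylOf, Matrix.of_apply]
  linarith [hL a b c d]

/-- The volume form is constant to first order in a parallel frame. -/
theorem pd_sqrt_det_mul_det (h : IsDualSolitonOn G F s ρ U) (hx : x ∈ U)
    (hA : pullTwo A₀ (G x) = 1) (p : Fin 4) :
    DifferentiableAt ℝ (fun y => Real.sqrt (G y).det * (parallelFrame G x A₀ y).det) x ∧
    pd p (fun y => Real.sqrt (G y).det * (parallelFrame G x A₀ y).det) x = 0 := by
  have d1 : DifferentiableAt ℝ (fun y => (G y).det) x :=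
    h.metric.smooth.det.differentiableAt_of_isOpen h.metric.isOpen hx
  have d2 : DifferentiableAt ℝ (fun y => (parallelFrame G x A₀ y).det) x :=
    (smooth_parallelFrame G x A₀ U).det.differentiableAt_of_isOpen h.metric.isOpen hx
  have d3 := d1.sqrt (h.metric.det_pos hx).ne'
  have d4 := d3.fun_mul d2
  refine ⟨d4, pd_eq_zero_of_mul_self p d4 ?_ ?_⟩
  · rw [parallelFrame_self]
    exact mul_ne_zero (Real.sqrt_ne_zero'.2 (h.metric.det_pos hx))
      (isUnit_det_of_pullTwo hA).ne_zero
  · -- The square is the determinant of the metric in the frame.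
    have h1 : (fun y => Real.sqrt (G y).det * (parallelFrame G x A₀ y).det
        * (Real.sqrt (G y).det * (parallelFrame G x A₀ y).det)) =ᶠ[nhds x]
        fun y => (pullTwo (parallelFrame G x A₀ y) (G y)).det := by
      filter_upwards [h.metric.isOpen.mem_nhds hx] with y hy
      rw [pullTwo, Matrix.det_mul, Matrix.det_mul, Matrix.det_transpose]
      linear_combination (parallelFrame G x A₀ y).det ^ 2
        * Real.mul_self_sqrt (h.metric.det_pos hy).le
    rw [pd_congr h1]
    exact pd_det_eq_zero p ((h.metric.matDiffAt_parallelFrame hx).pullTwo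
      (h.metric.smooth.matDiffAt h.metric.isOpen hx)) (h.metric.matPd_pullTwo_metric hx p)

/-- The Weyl tensor and its covariant derivatives satisfy the same duality relation. -/
theorem exists_dualPairs (h : IsDualSolitonOn G F s ρ U) (hx : x ∈ U)
    (hA : pullTwo A₀ (G x) = 1) :
    ∃ σ, DualPairs σ (weylOf 1 (pullFour A₀ fun i j => riemMat G i j x)
      (pullTwo A₀ (ricMat G x)) (scalarCurvature G x)) ∧
      ∀ e, DualPairs σ (weylOf 1 (frameCovRiem G x A₀ e) (frameCovRic G x A₀ e)
        (frameDScalar G x A₀ e)) := by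
  refine ⟨s x * (Real.sqrt (G x).det * A₀.det), ?_, ?_⟩
  · have h1 := h.weylOf_add_epsOf hx (isUnit_det_of_pullTwo hA) rfl
    rw [hA, inv_one] at h1
    exact dualPairs_of_epsOf (weylOf_swap fun a b c d =>
      congrFun (congrFun (pullFour_swap (fun i j => riemMat_swap G i j x) a b) c) d) h1
  have key : ∀ p, DualPairs (s x * (Real.sqrt (G x).det * A₀.det))
      (weylOf 1 (pullFour A₀ fun i j => covRiem G p i j x) (pullTwo A₀ (covTwo G p (ricMat G) x))
        (pd p (scalarCurvature G) x)) := by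
    intro p
    refine dualPairs_of_epsOf (weylOf_swap fun a b c d =>
      congrFun (congrFun (pullFour_swap (fun i j => covRiem_swap G x p i j) a b) c) d) ?_
    intro a b k l
    have hAd := h.metric.matDiffAt_parallelFrame (A₀ := A₀) hx
    have hAp := matPd_parallelFrame G x A₀ p
    have hR : ∀ i j, MatDiffAt (riemMat G i j) x := fun i j =>
      (h.metric.smooth_riemMat i j).matDiffAt h.metric.isOpen hx
    have hP := h.metric.smooth_ricMat.matDiffAt h.metric.isOpen hx
    have hS := h.metric.smooth_scalarCurvature.differentiableAt_of_isOpen h.metric.isOpen hx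
    have hg := hAd.pullTwo (h.metric.smooth.matDiffAt h.metric.isOpen hx)
    obtain ⟨hHd, hH1, hH0⟩ := h.metric.inv_pullTwo_metric hx hA p
    set W : R4 → Fin 4 → Fin 4 → Matrix (Fin 4) (Fin 4) ℝ := fun y =>
      weylOf (pullTwo (parallelFrame G x A₀ y) (G y))
        (pullFour (parallelFrame G x A₀ y) fun i j => riemMat G i j y)
        (pullTwo (parallelFrame G x A₀ y) (ricMat G y)) (scalarCurvature G y) with hW
    have hWd := pd_weylOf (p := p) (L := fun y => pullFour (parallelFrame G x A₀ y)
      fun i j => riemMat G i j y) hg (hAd.pullTwo hP) (fun i j => hAd.pullFour hR i j) hS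
      (by rw [parallelFrame_self, hA]) (h.metric.matPd_pullTwo_metric hx p)
    simp only [matPd_pullFour hAd hR hAp, matPd_pullTwo hAd hP hAp, parallelFrame_self] at hWd
    have hWm : ∀ i j, matPd p (fun y => W y i j) x
        = weylOf 1 (pullFour A₀ fun i j => covRiem G p i j x)
          (pullTwo A₀ (covTwo G p (ricMat G) x)) (pd p (scalarCurvature G) x) i j := by
      intro i j
      ext k l
      exact (hWd i j k l).2
    have hE := pd_epsOf (p := p) (L := W) hHd (fun i j k l => (hWd i j k l).1) hH1 hH0 a b k l
    simp only [hWm] at hE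
    have hσ := h.pd_sqrt_det_mul_det hx hA p
    have h0 : pd p (fun y => W y a b k l
        + 1 / 2 * (s x * (Real.sqrt (G y).det * (parallelFrame G x A₀ y).det))
        * epsOf (pullTwo (parallelFrame G x A₀ y) (G y))⁻¹ (W y) a b k l) x = 0 := by
      rw [← pd_const (x := x) p 0]
      refine pd_congr ?_
      filter_upwards [h.metric.isOpen.mem_nhds hx, h.locallyConstant x hx,
        eventually_isUnit_det (G := G) (x := x) (isUnit_det_of_pullTwo hA)] with y hy hs hu
      rw [← hs]
      exact h.weylOf_add_epsOf hy hu rfl a b k l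
    have hc := (hσ.1.const_mul (s x)).const_mul (1 / 2)
    rw [pd_add p (hWd a b k l).1 (hc.fun_mul hE.1), pd_mul p hc hE.1,
      pd_const_mul p _ (hσ.1.const_mul (s x)), pd_const_mul p _ hσ.1, hσ.2, hE.2,
      (hWd a b k l).2, parallelFrame_self] at h0
    linarith
  intro e
  -- The relation is linear in the direction of differentiation.
  have hlin : ∀ a b k l, weylOf 1 (frameCovRiem G x A₀ e) (frameCovRic G x A₀ e)
      (frameDScalar G x A₀ e) a b k l = ∑ p, A₀ p e *
        weylOf 1 (pullFour A₀ fun i j => covRiem G p i j x)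
          (pullTwo A₀ (covTwo G p (ricMat G) x)) (pd p (scalarCurvature G) x) a b k l := by
    intro a b k l
    simp only [weylOf, frameCovRiem, frameCovRic, frameDScalar, Matrix.of_apply, Matrix.sum_apply,
      Matrix.smul_apply, smul_eq_mul, Fin.sum_univ_four]
    ring
  have hcomb : ∀ (τ : ℝ) (a b a' b' k l : Fin 4),
      (∀ p, weylOf 1 (pullFour A₀ fun i j => covRiem G p i j x)
          (pullTwo A₀ (covTwo G p (ricMat G) x)) (pd p (scalarCurvature G) x) a b k l
        + τ * weylOf 1 (pullFour A₀ fun i j => covRiem G p i j x)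
          (pullTwo A₀ (covTwo G p (ricMat G) x)) (pd p (scalarCurvature G) x) a' b' k l = 0) →
      weylOf 1 (frameCovRiem G x A₀ e) (frameCovRic G x A₀ e) (frameDScalar G x A₀ e) a b k l
        + τ * weylOf 1 (frameCovRiem G x A₀ e) (frameCovRic G x A₀ e)
          (frameDScalar G x A₀ e) a' b' k l = 0 := by
    intro τ a b a' b' k l hp
    rw [hlin, hlin, Finset.mul_sum, ← Finset.sum_add_distrib]
    refine Finset.sum_eq_zero fun p _ => ?_
    linear_combination A₀ p e * hp p
  constructor <;> intro k l
  · exact hcomb _ _ _ _ _ _ _ fun p => (key p).h01 k l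
  · rw [sub_eq_add_neg, ← neg_mul]
    exact hcomb _ _ _ _ _ _ _ fun p => by rw [neg_mul, ← sub_eq_add_neg]; exact (key p).h02 k l
  · exact hcomb _ _ _ _ _ _ _ fun p => (key p).h03 k l
  · exact hcomb _ _ _ _ _ _ _ fun p => (key p).h12 k l
  · rw [sub_eq_add_neg, ← neg_mul]
    exact hcomb _ _ _ _ _ _ _ fun p => by rw [neg_mul, ← sub_eq_add_neg]; exact (key p).h13 k l
  · exact hcomb _ _ _ _ _ _ _ fun p => (key p).h23 k l

end IsDualSolitonOn

end FrameCurvature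

/-! ### The splitting of the Ricci tensor and the vanishing of the Weyl tensor -/

section LocalResult

namespace IsDualSolitonOn

variable {G : R4 → Matrix (Fin 4) (Fin 4) ℝ} {x : R4} {U : Set R4} {F s : R4 → ℝ} {ρ : ℝ}

/-- The Ricci tensor of a half conformally flat gradient soliton is a multiple of the metric up to
a multiple of `dF ⊗ dF`. -/
theorem exists_ricMat_eq (h : IsDualSolitonOn G F s ρ U) (hx : x ∈ U)
    (hF : (fun i => pd i F x) ≠ 0) :
    ∃ μ ν : ℝ, ∀ i j, ricci G x i j = μ * G x i j + ν * (pd i F x * pd j F x) := by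
  obtain ⟨A, φ, hφ, hA, hAF⟩ := exists_adapted_frame (h.metric.posDef x hx) hF
  obtain ⟨σ, hW, hDW⟩ := h.exists_dualPairs hx hA
  obtain ⟨μ, hμ⟩ := (h.solitonFrame hx hA hφ hAF).ricci_split hW hDW
  set ν := (pullTwo A (ricMat G x) 0 0 - μ) / φ ^ 2 with hν
  refine ⟨μ, ν, fun i j => ?_⟩
  have h1 : ricMat G x - (μ • G x + ν • Matrix.of fun i j => pd i F x * pd j F x) = 0 := by
    refine eq_zero_of_pullTwo (isUnit_det_of_pullTwo hA) ?_
    rw [pullTwo_sub, pullTwo_add, pullTwo_smul, pullTwo_smul, hA]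
    ext a b
    have h2 : pullTwo A (Matrix.of fun i j => pd i F x * pd j F x) a b
        = (∑ i, A i a * pd i F x) * ∑ j, A j b * pd j F x := by
      rw [pullTwo_apply, Finset.sum_mul_sum]
      exact Finset.sum_congr rfl fun i _ => Finset.sum_congr rfl fun j _ => by
        rw [Matrix.of_apply]
        ring
    simp only [Matrix.sub_apply, Matrix.add_apply, Matrix.smul_apply, smul_eq_mul, h2, hAF, hμ a b,
      Matrix.zero_apply]
    rw [hν]
    field_simp
    ring
  have h2 := congrFun (congrFun h1 i) j
  simp only [ricMat, Matrix.sub_apply, Matrix.add_apply, Matrix.smul_apply, smul_eq_mul,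
    Matrix.of_apply, Matrix.zero_apply] at h2
  linarith

/-- The squared norm of the gradient. -/
def gradSq (G : R4 → Matrix (Fin 4) (Fin 4) ℝ) (F : R4 → ℝ) (y : R4) : ℝ :=
  ∑ i, ∑ j, (G y)⁻¹ i j * (pd i F y * pd j F y)

/-- The value `Ric(∇F, ∇F)`. -/
def ricGrad (G : R4 → Matrix (Fin 4) (Fin 4) ℝ) (F : R4 → ℝ) (y : R4) : ℝ :=
  ∑ i, ∑ j, ricci G y i j * (gradient G F y i * gradient G F y j)

theorem gradSq_pos (h : IsMetricOn G U) (hx : x ∈ U) (hF : (fun i => pd i F x) ≠ 0) :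
    0 < gradSq G F x := by
  have h1 := (h.posDef x hx).inv.dotProduct_mulVec_pos hF
  refine h1.trans_eq ?_
  simp only [gradSq, dotProduct, Matrix.mulVec, Finset.mul_sum, star_trivial]
  exact Finset.sum_congr rfl fun i _ => Finset.sum_congr rfl fun j _ => by ring

theorem sum_mul_gradient (h : IsMetricOn G U) (hx : x ∈ U) (F : R4 → ℝ) (i : Fin 4) :
    ∑ j, G x i j * gradient G F x j = pd i F x := by
  have h1 : ∑ j, G x i j * gradient G F x j
      = (G x).mulVec ((G x)⁻¹.mulVec fun i => pd i F x) i := rfl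
  rw [h1, Matrix.mulVec_mulVec, Matrix.mul_nonsing_inv _ (h.det_ne_zero x hx).isUnit,
    Matrix.one_mulVec]

theorem sum_gradient_mul_pd (G : R4 → Matrix (Fin 4) (Fin 4) ℝ) (F : R4 → ℝ) (x : R4) :
    ∑ i, gradient G F x i * pd i F x = gradSq G F x := by
  simp only [gradient, gradSq, Finset.sum_mul]
  exact Finset.sum_congr rfl fun i _ => Finset.sum_congr rfl fun j _ => by ring

/-- The two coefficients are rational expressions in the scalar curvature, `Ric(∇F, ∇F)` and
`|∇F|²`. -/
theorem coeff_eq (h : IsMetricOn G U) (hx : x ∈ U) (hF : (fun i => pd i F x) ≠ 0) {μ ν : ℝ}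
    (hR : ∀ i j, ricci G x i j = μ * G x i j + ν * (pd i F x * pd j F x)) :
    μ = (scalarCurvature G x - ricGrad G F x / gradSq G F x) / 3 ∧
    ν = (scalarCurvature G x - 4 * μ) / gradSq G F x := by
  have hq := (gradSq_pos h hx hF).ne'
  have h1 : scalarCurvature G x = 4 * μ + ν * gradSq G F x := by
    have h2 : ∑ j, ∑ l, (G x)⁻¹ j l * G x j l = 4 := by
      have h3 : ((G x)⁻¹ * G x).trace = 4 := by
        rw [Matrix.nonsing_inv_mul _ (h.det_ne_zero x hx).isUnit]
        simp
      rw [← h3]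
      simp only [Matrix.trace, Matrix.diag, Matrix.mul_apply]
      exact Finset.sum_congr rfl fun j _ => Finset.sum_congr rfl fun l _ => by
        rw [h.symm hx]
    simp only [scalarCurvature, hR, gradSq, mul_add, Finset.sum_add_distrib]
    rw [← h2]
    simp only [Finset.mul_sum, Finset.sum_mul]
    congr 1
    · exact Finset.sum_congr rfl fun j _ => Finset.sum_congr rfl fun l _ => by ring
    · exact Finset.sum_congr rfl fun j _ => Finset.sum_congr rfl fun l _ => by ring
  have h4 : ricGrad G F x = μ * gradSq G F x + ν * gradSq G F x ^ 2 := by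
    have h5 : ∑ i, ∑ j, G x i j * (gradient G F x i * gradient G F x j) = gradSq G F x := by
      rw [← sum_gradient_mul_pd]
      refine Finset.sum_congr rfl fun i _ => ?_
      rw [← sum_mul_gradient h hx, Finset.mul_sum]
      exact Finset.sum_congr rfl fun j _ => by ring
    have h6 : ∑ i, ∑ j, pd i F x * pd j F x * (gradient G F x i * gradient G F x j)
        = gradSq G F x ^ 2 := by
      rw [sq, ← sum_gradient_mul_pd, Finset.sum_mul_sum]
      exact Finset.sum_congr rfl fun i _ => Finset.sum_congr rfl fun j _ => by ring
    rw [← h6]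
    conv_rhs => rw [← h5]
    simp only [ricGrad, hR, add_mul, Finset.sum_add_distrib, Finset.mul_sum]
    congr 1
    · exact Finset.sum_congr rfl fun j _ => Finset.sum_congr rfl fun l _ => by ring
    · exact Finset.sum_congr rfl fun j _ => Finset.sum_congr rfl fun l _ => by ring
  constructor
  · rw [h4, h1]
    field_simp
    ring
  · rw [h1]
    field_simp
    ring

/-- The Weyl tensor of a half conformally flat gradient soliton vanishes where the gradient
does not. -/
theorem weyl_eq_zero (h : IsDualSolitonOn G F s ρ U) (hx : x ∈ U)
    (hF : (fun i => pd i F x) ≠ 0) (i j k l : Fin 4) : weyl G x i j k l = 0 := by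
  obtain ⟨A, φ, hφ, hA, hAF⟩ := exists_adapted_frame (h.metric.posDef x hx) hF
  obtain ⟨σ, hW, hDW⟩ := h.exists_dualPairs hx hA
  have hframe := h.solitonFrame hx hA hφ hAF
  have hU := h.metric.isOpen
  have hdF : ∀ i, DifferentiableAt ℝ (pd i F) x := fun i =>
    (h.smooth.pd hU i).differentiableAt_of_isOpen hU hx
  have hinv := h.metric.smooth_inv.matDiffAt hU hx
  have hric := h.metric.smooth_ricMat.matDiffAt hU hx
  have hS := h.metric.smooth_scalarCurvature.differentiableAt_of_isOpen hU hx
  have hq0 := (gradSq_pos h.metric hx hF).ne'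
  have hq : DifferentiableAt ℝ (gradSq G F) x :=
    DifferentiableAt.fun_sum fun i _ => DifferentiableAt.fun_sum fun j _ =>
      (hinv i j).fun_mul ((hdF i).fun_mul (hdF j))
  have hgrad : ∀ i, DifferentiableAt ℝ (fun y => gradient G F y i) x := fun i =>
    DifferentiableAt.fun_sum fun j _ => (hinv i j).fun_mul (hdF j)
  have hb : DifferentiableAt ℝ (ricGrad G F) x :=
    DifferentiableAt.fun_sum fun i _ => DifferentiableAt.fun_sum fun j _ =>
      (hric i j).fun_mul ((hgrad i).fun_mul (hgrad j))
  set μ : R4 → ℝ := fun y => (scalarCurvature G y - ricGrad G F y / gradSq G F y) / 3 with hμ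
  set ν : R4 → ℝ := fun y => (scalarCurvature G y - 4 * μ y) / gradSq G F y with hν
  have hμd : DifferentiableAt ℝ μ x := by
    simp only [hμ, div_eq_mul_inv]
    exact (hS.fun_sub (hb.fun_mul (hq.fun_inv hq0))).mul_const _
  have hνd : DifferentiableAt ℝ ν x := by
    simp only [hν, div_eq_mul_inv]
    exact (hS.fun_sub (hμd.const_mul 4)).fun_mul (hq.fun_inv hq0)
  have hFne : ∀ᶠ y in nhds x, (fun i => pd i F y) ≠ 0 := by
    obtain ⟨i, hi⟩ := Function.ne_iff.1 hF
    filter_upwards [(hdF i).continuousAt.eventually_ne hi] with y hy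
    exact Function.ne_iff.2 ⟨i, hy⟩
  have hR : ∀ᶠ y in nhds x, ∀ i j,
      ricci G y i j = μ y * G y i j + ν y * (pd i F y * pd j F y) := by
    filter_upwards [hFne, hU.mem_nhds hx] with y hy hyU i j
    obtain ⟨m, n, hmn⟩ := h.exists_ricMat_eq hyU hy
    obtain ⟨h1, h2⟩ := coeff_eq h.metric hyU hy hmn
    have h3 : μ y = m := h1.symm
    have h4 : ν y = n := by rw [hν, h2, ← h3]
    rw [h3, h4, hmn]
  have hRx := hR.self_of_nhds
  -- Differentiate `Ric = μ g + ν dF ⊗ dF` in a parallel frame.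
  have hAd := h.metric.matDiffAt_parallelFrame (A₀ := A) hx
  have hAp := matPd_parallelFrame G x A
  set fr : Fin 4 → R4 → ℝ := fun a y => ∑ i, parallelFrame G x A y i a * pd i F y with hfr
  have hfrd : ∀ a, DifferentiableAt ℝ (fr a) x := fun a =>
    DifferentiableAt.fun_sum fun i _ => (hAd i a).fun_mul (hdF i)
  have hfrx : ∀ a, a ≠ 0 → fr a x = 0 := by
    intro a ha
    simp only [hfr, parallelFrame_self]
    rw [hAF a, Matrix.one_apply_ne ha.symm, mul_zero]
  have hpull : ∀ (y : R4), (∀ i j, ricci G y i j = μ y * G y i j + ν y * (pd i F y * pd j F y)) →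
      ∀ b d, pullTwo (parallelFrame G x A y) (ricMat G y) b d
        = μ y * pullTwo (parallelFrame G x A y) (G y) b d + ν y * (fr b y * fr d y) := by
    intro y hy b d
    simp only [pullTwo_apply, ricMat, Matrix.of_apply, hy, hfr]
    rw [Finset.sum_mul_sum]
    simp only [Finset.mul_sum]
    rw [← Finset.sum_add_distrib]
    refine Finset.sum_congr rfl fun i _ => ?_
    rw [← Finset.sum_add_distrib]
    exact Finset.sum_congr rfl fun j _ => by ring
  have hDP : ∀ p b d, b ≠ 0 → d ≠ 0 → pullTwo A (covTwo G p (ricMat G) x) b d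
      = pd p μ x * (1 : Matrix (Fin 4) (Fin 4) ℝ) b d := by
    intro p b d hb0 hd0
    have h1 := matPd_pullTwo hAd hric (hAp p)
    rw [parallelFrame_self] at h1
    rw [← h1]
    have hg := (hAd.pullTwo (h.metric.smooth.matDiffAt hU hx)) b d
    have hg0 : pd p (fun y => pullTwo (parallelFrame G x A y) (G y) b d) x = 0 :=
      congrFun (congrFun (h.metric.matPd_pullTwo_metric hx p) b) d
    have hff := (hfrd b).fun_mul (hfrd d)
    have h2 : matPd p (fun y => pullTwo (parallelFrame G x A y) (ricMat G y)) x b d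
        = pd p (fun y => μ y * pullTwo (parallelFrame G x A y) (G y) b d
          + ν y * (fr b y * fr d y)) x :=
      pd_congr (hR.mono fun y hy => hpull y hy b d)
    rw [h2, pd_add p (hμd.fun_mul hg) (hνd.fun_mul hff), pd_mul p hμd hg, pd_mul p hνd hff,
      pd_mul p (hfrd b) (hfrd d), hg0, hfrx b hb0, hfrx d hd0]
    simp only [parallelFrame_self, hA]
    ring
  have hweyl := hframe.weyl_eq_zero hW (fun a ha => ?_) (fun e => ∑ p, A p e * pd p μ x)
    fun e b d _ hb0 hd0 => ?_
  · have h1 : ∀ a b c d, pullFour A (fun i j => Matrix.of (weyl G x i j)) a b c d = 0 := by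
      intro a b c d
      have h2 : pullFour A (fun i j => Matrix.of (weyl G x i j))
          = weylOf 1 (pullFour A fun i j => riemMat G i j x) (pullTwo A (ricMat G x))
            (scalarCurvature G x) := by
        rw [← hA, ← pullFour_weylOf]
        rfl
      rw [h2]
      exact hweyl a b c d
    exact congrFun (congrFun (eq_zero_of_pullFour (isUnit_det_of_pullTwo hA) h1 i j) k) l
  · have h1 := hpull x hRx a 0
    rw [hfrx a ha, parallelFrame_self, hA, Matrix.one_apply_ne ha] at h1
    rw [h1]
    ring
  · simp only [frameCovRic, Matrix.sum_apply, Matrix.smul_apply, smul_eq_mul, Finset.sum_mul]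
    refine Finset.sum_congr rfl fun p _ => ?_
    rw [hDP p b d hb0 hd0]
    ring

/-- The gradient is an eigenvector of the Ricci tensor, and the Ricci tensor is a multiple of the
metric on the orthogonal complement. -/
theorem ricci_splits (h : IsDualSolitonOn G F s ρ U) (hx : x ∈ U)
    (hF : (fun i => pd i F x) ≠ 0) :
    gradient G F x ≠ 0 ∧
    (∃ lam : ℝ, ∀ i, ∑ j, ricci G x i j * gradient G F x j
      = lam * ∑ j, G x i j * gradient G F x j) ∧
    (∃ mu : ℝ, ∀ a b : Fin 4 → ℝ,
      (∑ i, ∑ j, G x i j * a i * gradient G F x j = 0) →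
      (∑ i, ∑ j, G x i j * b i * gradient G F x j = 0) →
      ∑ i, ∑ j, ricci G x i j * a i * b j = mu * ∑ i, ∑ j, G x i j * a i * b j) := by
  obtain ⟨μ, ν, hR⟩ := h.exists_ricMat_eq hx hF
  have hG := sum_mul_gradient h.metric hx F
  refine ⟨fun h0 => hF ?_, ⟨μ + ν * gradSq G F x, fun i => ?_⟩, ⟨μ, fun a b _ hb => ?_⟩⟩
  · funext i
    rw [← hG i, h0]
    simp
  · rw [hG, ← sum_gradient_mul_pd, add_mul]
    simp only [hR, add_mul, Finset.sum_add_distrib, mul_assoc, ← Finset.mul_sum, hG]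
    simp only [mul_comm (pd _ F x) (gradient G F x _), mul_comm (∑ j, _) (pd i F x)]
  · have h1 : ∑ i, pd i F x * b i = 0 := by
      rw [← hb]
      refine Finset.sum_congr rfl fun i _ => ?_
      rw [← hG i, Finset.sum_mul]
      exact Finset.sum_congr rfl fun j _ => by ring
    have h2 : ∑ i, ∑ j, ricci G x i j * a i * b j
        = μ * ∑ i, ∑ j, G x i j * a i * b j
          + ν * ((∑ i, pd i F x * a i) * ∑ j, pd j F x * b j) := by
      rw [Finset.sum_mul_sum]
      simp only [hR, add_mul, Finset.sum_add_distrib, Finset.mul_sum]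
      congr 1
      · exact Finset.sum_congr rfl fun i _ => Finset.sum_congr rfl fun j _ => by ring
      · exact Finset.sum_congr rfl fun i _ => Finset.sum_congr rfl fun j _ => by ring
    rw [h2, h1, mul_zero, mul_zero, add_zero]

end IsDualSolitonOn

end LocalResult

/-! ### Passage from the manifold to its charts -/

section Chart

variable {M : Type*} [TopologicalSpace M] [ChartedSpace R4 M]
  {e : OpenPartialHomeomorph M R4}

theorem mdifferentiable_of_mem_maximalAtlas (he : e ∈ IsManifold.maximalAtlas (𝓡 4) ∞ M) :
    e.MDifferentiable (𝓡 4) (𝓡 4) :=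
  ⟨(contMDiffOn_of_mem_maximalAtlas he).mdifferentiableOn (by simp),
    (contMDiffOn_symm_of_mem_maximalAtlas he).mdifferentiableOn (by simp)⟩

theorem contDiffOn_comp_symm {f : M → ℝ} (hf : ContMDiff (𝓡 4) 𝓘(ℝ, ℝ) ∞ f)
    (he : e ∈ IsManifold.maximalAtlas (𝓡 4) ∞ M) : ContDiffOn ℝ ∞ (f ∘ e.symm) e.target :=
  contMDiffOn_iff_contDiffOn.1
    (hf.comp_contMDiffOn (contMDiffOn_symm_of_mem_maximalAtlas he))

theorem pd_comp_symm_ne_zero {f : M → ℝ} (hf : ContMDiff (𝓡 4) 𝓘(ℝ, ℝ) ∞ f)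
    (he : e ∈ IsManifold.maximalAtlas (𝓡 4) ∞ M) {q : M} (hqe : q ∈ e.source)
    (hq : mfderiv (𝓡 4) 𝓘(ℝ, ℝ) f q ≠ 0) :
    (fun i => pd i (f ∘ e.symm) (e q)) ≠ 0 := by
  intro h0
  apply hq
  have h1 : fderiv ℝ (f ∘ e.symm) (e q) = 0 := by
    ext u
    rw [fderiv_eq_sum_pd]
    simp [fun i => congrFun h0 i]
  have h2 : f =ᶠ[nhds q] (f ∘ e.symm) ∘ e := by
    filter_upwards [e.open_source.mem_nhds hqe] with y hy
    simp [e.left_inv hy]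
  have h3 : DifferentiableAt ℝ (f ∘ e.symm) (e q) :=
    (contDiffOn_comp_symm hf he).differentiableAt_of_isOpen e.open_target (e.map_source hqe)
  have h4 : MDifferentiableAt (𝓡 4) (𝓡 4) e q :=
    (mdifferentiable_of_mem_maximalAtlas he).mdifferentiableAt hqe
  rw [h2.mfderiv_eq, mfderiv_comp q h3.mdifferentiableAt h4, mfderiv_eq_fderiv, h1]
  exact ContinuousLinearMap.zero_comp _

variable [IsManifold (𝓡 4) ∞ M]

theorem contMDiffAt_coordVec (he : e ∈ IsManifold.maximalAtlas (𝓡 4) ∞ M) {x : R4}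
    (hx : x ∈ e.target) (i : Fin 4) :
    ContMDiffAt (𝓡 4) (𝓡 4).tangent ∞
      (fun y => (⟨e.symm y, coordVec e y i⟩ : TangentBundle (𝓡 4) M)) x := by
  have h1 : ContMDiffAt (𝓡 4) (𝓡 4) ∞ e.symm x := contMDiffAt_symm_of_mem_maximalAtlas he hx
  have h2 : ContMDiffAt (𝓡 4) (𝓡 4).tangent ∞
      (fun y : R4 => (⟨y, (EuclideanSpace.single i 1 : R4)⟩ : TangentBundle (𝓡 4) R4)) x :=
    contMDiffAt_vectorSpace_iff_contDiffAt.2 contDiffAt_const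
  have : IsManifold (𝓡 4) 1 M := IsManifold.of_le (n := ∞) (by simp)
  have h3 := h1.mfderiv_const (m := ∞) (by simp)
  exact ContMDiffAt.clm_apply_of_inCoordinates h3 h2 h1

theorem contDiffOn_metricIn (g : Metric M) (he : e ∈ IsManifold.maximalAtlas (𝓡 4) ∞ M) :
    MatSmoothOn (metricIn g e) e.target := by
  intro i j x hx
  have h1 : ContMDiffAt (𝓡 4) (𝓡 4) ∞ e.symm x := contMDiffAt_symm_of_mem_maximalAtlas he hx
  have h2 : ContMDiffAt (𝓡 4) ((𝓡 4).prod 𝓘(ℝ)) ∞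
      (fun y => Bundle.TotalSpace.mk' ℝ (E := Bundle.Trivial M ℝ) (e.symm y)
        (g.inner (e.symm y) (coordVec e y i) (coordVec e y j))) x := by
    apply ContMDiffAt.clm_bundle_apply₂ (F₁ := R4) (F₂ := R4)
    · exact g.contMDiff.contMDiffAt.comp x h1
    · exact contMDiffAt_coordVec he hx i
    · exact contMDiffAt_coordVec he hx j
  rw [Bundle.contMDiffAt_totalSpace] at h2
  exact (contMDiffAt_iff_contDiffAt.1 h2.2).contDiffWithinAt

theorem isMetricOn_metricIn (g : Metric M) (he : e ∈ IsManifold.maximalAtlas (𝓡 4) ∞ M) :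
    IsMetricOn (metricIn g e) e.target where
  isOpen := e.open_target
  smooth := contDiffOn_metricIn g he
  posDef x hx := by
    have hinj : Function.Injective (mfderiv (𝓡 4) (𝓡 4) e.symm x) :=
      (mdifferentiable_of_mem_maximalAtlas he).symm.mfderiv_injective hx
    rw [Matrix.posDef_iff_dotProduct_mulVec]
    refine ⟨?_, fun {v} hv => ?_⟩
    · ext i j
      simpa [metricIn] using g.symm (e.symm x) (coordVec e x j) (coordVec e x i)
    · set w : TangentSpace (𝓡 4) (e.symm x) := ∑ i, v i • coordVec e x i with hw
      have hw' : w = mfderiv (𝓡 4) (𝓡 4) e.symm x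
          (∑ i, v i • (EuclideanSpace.single i 1 : R4) : R4) := by
        simp only [hw, coordVec]
        erw [map_sum]
        refine Finset.sum_congr rfl fun i _ => ?_
        erw [map_smul]
      have hw0 : w ≠ 0 := by
        intro h0
        apply hv
        have h1 : (∑ i, v i • (EuclideanSpace.single i 1 : R4) : R4) = 0 := by
          apply hinj
          rw [← hw', h0]
          exact (map_zero _).symm
        funext j
        have h2 := congrArg (fun u : R4 => u j) h1
        simpa [Finset.sum_apply, Pi.single_apply] using h2
      refine (g.pos (e.symm x) w hw0).trans_eq ?_
      simp only [hw, map_sum, map_smul, sum_apply,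
        smul_apply, smul_eq_mul, dotProduct, Matrix.mulVec, metricIn,
        Matrix.of_apply, Finset.mul_sum, star_trivial]
      refine Finset.sum_congr rfl fun i _ => Finset.sum_congr rfl fun j _ => ?_
      rw [g.symm (e.symm x) (coordVec e x j) (coordVec e x i)]
      ring

/-- In every chart, an anti-self-dual gradient Ricci soliton is a soliton on an open subset of
`ℝ⁴`. -/
theorem isDualSolitonOn_of_chart {o : ManifoldOrientation M} {g : Metric M} {f : M → ℝ} {ρ : ℝ}
    (hsol : IsGradientRicciSoliton g f ρ) (hW : IsAntiSelfDual o g)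
    (he : e ∈ IsManifold.maximalAtlas (𝓡 4) ∞ M) :
    IsDualSolitonOn (metricIn g e) (f ∘ e.symm) (fun x => (frameSign o.tangent e x : ℝ)) ρ
      e.target where
  metric := isMetricOn_metricIn g he
  smooth := contDiffOn_comp_symm hsol.smooth he
  equation := hsol.equation e he
  weylPlus_eq_zero := hW e he
  locallyConstant x hx := (o.locallyConstant e he x hx).mono fun y hy => by rw [hy]

end Chart

end RicciSoliton

end

theorem lemma2p3 {M : Type*} [TopologicalSpace M] [ChartedSpace RicciSoliton.R4 M]
    [IsManifold (𝓡 4) ∞ M] (o : RicciSoliton.ManifoldOrientation M) (g : RicciSoliton.Metric M)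
    (f : M → ℝ)
    (hsoliton : RicciSoliton.IsGradientSteadySoliton g f ∨
      RicciSoliton.IsGradientShrinkingSoliton g f)
    (hW : RicciSoliton.IsAntiSelfDual o g) (q : M)
    (hq : mfderiv (𝓡 4) 𝓘(ℝ, ℝ) f q ≠ 0) :
    RicciSoliton.WeylVanishesAt g q ∧ RicciSoliton.RicciSplitsAlongGradientAt g f q := by
  obtain ⟨ρ, hsol⟩ : ∃ ρ, RicciSoliton.IsGradientRicciSoliton g f ρ := by
    rcases hsoliton with h | ⟨ρ, -, h⟩
    exacts [⟨0, h⟩, ⟨ρ, h⟩]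
  exact ⟨fun e he hqe => (RicciSoliton.isDualSolitonOn_of_chart hsol hW he).weyl_eq_zero
      (e.map_source hqe) (RicciSoliton.pd_comp_symm_ne_zero hsol.smooth he hqe hq),
    fun e he hqe => (RicciSoliton.isDualSolitonOn_of_chart hsol hW he).ricci_splits
      (e.map_source hqe) (RicciSoliton.pd_comp_symm_ne_zero hsol.smooth he hqe hq)⟩
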